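/- Let $N\ge 3$. All functions are real valued and are identified when they agree almost everywhere. Let $D^{1,2}(\mathbb{R}^N)$ be the set of $u\in L^{\frac{2N}{N-2}}(\mathbb{R}^N)$ whose weak gradient $\nabla u$ belongs to $L^2(\mathbb{R}^N)$, and let $$E=\Big\{u\in D^{1,2}(\mathbb{R}^N):\ \int_{\mathbb{R}^N}\int_{\mathbb{R}^N}\frac{u^2(x)\,u^2(y)}{|x-y|^{N-2}}\,dx\,dy<+\infty\Big\}.$$ Let $E_r$ be the set of radial functions in $E$, let $C_0^\infty(\mathbb{R}^N)$ be the set of smooth functions with compact support, and let $C_{0,r}^\infty(\mathbb{R}^N)$ be the set of radial functions in $C_0^\infty(\mathbb{R}^N)$. For $u\in E$ define $$\|u\|_E=\left(\int_{\mathbb{R}^N}|\nabla u(x)|^2\,dx+\left(\int_{\mathbb{R}^N}\int_{\mathbb{R}^N}\frac{u^2(x)\,u^2(y)}{|x-y|^{N-2}}\,dx\,dy\right)^{1/2}\right)^{1/2}.$$ Then $E$ is a vector space, $\|\cdot\|_E$ is a norm on $E$, and $(E,\|\cdot\|_E)$ is a uniformly convex Banach space. Moreover, $C_0^\infty(\mathbb{R}^N)$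 is contained and dense in $E$, and $C_{0,r}^\infty(\mathbb{R}^N)$ is contained and dense in $E_r$. -/

import Mathlib

open MeasureTheory Filter
open scoped ENNReal ContDiff

/-- `ℝ^N` with the Euclidean norm. -/
abbrev Space (N : ℕ) : Type := EuclideanSpace ℝ (Fin N)

/-- `C_0^∞(ℝ^N)`: smooth functions with compact support. -/
def IsTestFunction {N : ℕ} (φ : Space N → ℝ) : Prop :=
  ContDiff ℝ ∞ φ ∧ HasCompactSupport φ

/-- `f(x)` depends only on `|x|`. -/
def IsRadial {N : ℕ} (f : Space N → ℝ) : Prop :=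
  ∃ h : ℝ → ℝ, ∀ x, f x = h ‖x‖

/-- `g` is a weak (distributional) gradient of `u`: both are locally integrable and
`∫ u ∂_v φ = - ∫ (g · v) φ` for every test function `φ` and every direction `v`. -/
structure IsWeakGradient {N : ℕ} (u : Space N → ℝ) (g : Space N → Space N) : Prop where
  locallyIntegrable : LocallyIntegrable u
  locallyIntegrable_grad : LocallyIntegrable g
  integral_eq : ∀ φ : Space N → ℝ, IsTestFunction φ → ∀ v : Space N,
    ∫ x, u x * fderiv ℝ φ x v = - ∫ x, inner ℝ (g x) v * φ x

/-- A weak gradient is unique up to null sets. -/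
theorem IsWeakGradient.ae_eq {N : ℕ} {u : Space N → ℝ} {g₁ g₂ : Space N → Space N}
    (h₁ : IsWeakGradient u g₁) (h₂ : IsWeakGradient u g₂) : g₁ =ᵐ[volume] g₂ := by
  refine ae_eq_of_integral_contDiff_smul_eq h₁.locallyIntegrable_grad
    h₂.locallyIntegrable_grad fun φ hφ hc => ?_
  have key : ∀ {g : Space N → Space N}, LocallyIntegrable g → ∀ v : Space N,
      inner ℝ (∫ x, φ x • g x) v = ∫ x, inner ℝ (g x) v * φ x := by
    intro g hg v
    have hi : Integrable (fun x => φ x • g x) :=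
      hg.integrable_smul_left_of_hasCompactSupport hφ.continuous hc
    rw [real_inner_comm, ← integral_inner hi]
    refine integral_congr_ae (Eventually.of_forall fun x => ?_)
    simp only [inner_smul_right]
    rw [real_inner_comm, mul_comm]
  refine ext_inner_right ℝ fun v => ?_
  rw [key h₁.locallyIntegrable_grad, key h₂.locallyIntegrable_grad]
  have e₁ := h₁.integral_eq φ ⟨hφ, hc⟩ v
  have e₂ := h₂.integral_eq φ ⟨hφ, hc⟩ v
  linarith

open Classical in
/-- The weak gradient `∇u` (zero if `u` has none); well defined up to null sets by
`IsWeakGradient.ae_eq`. -/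
noncomputable def weakGrad {N : ℕ} (u : Space N → ℝ) : Space N → Space N :=
  if h : ∃ g, IsWeakGradient u g then h.choose else 0

/-- `u ∈ D^{1,2}(ℝ^N)`, for `N ≥ 3`: `u ∈ L^{2N/(N-2)}` has a weak gradient in `L^2`. -/
def MemD12 {N : ℕ} (u : Space N → ℝ) : Prop :=
  MemLp u (ENNReal.ofReal (2 * (N : ℝ) / ((N : ℝ) - 2))) ∧
    ∃ g, IsWeakGradient u g ∧ MemLp g 2

/-- The Coulomb energy `D(u²,u²) = ∫∫ u²(x) u²(y) / |x-y|^{N-2} dx dy ∈ [0,∞]`, for `N ≥ 3`. -/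
noncomputable def coulombEnergy {N : ℕ} (u : Space N → ℝ) : ℝ≥0∞ :=
  ∫⁻ x, ∫⁻ y, ENNReal.ofReal (u x ^ 2 * u y ^ 2 / ‖x - y‖ ^ (N - 2))

/-- `∫ |∇u|² dx ∈ [0,∞]`. -/
noncomputable def gradEnergy {N : ℕ} (u : Space N → ℝ) : ℝ≥0∞ :=
  ∫⁻ x, ENNReal.ofReal (‖weakGrad u x‖ ^ 2)

/-- `E(ℝ^N)`, as a set of classes of functions modulo equality almost everywhere. -/
def spaceE (N : ℕ) : Set (Space N →ₘ[volume] ℝ) :=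
  {u | MemD12 u ∧ coulombEnergy u < ⊤}

/-- `E_r(ℝ^N)`: the classes in `E(ℝ^N)` that have a radial representative. -/
def spaceEr (N : ℕ) : Set (Space N →ₘ[volume] ℝ) :=
  {u | u ∈ spaceE N ∧ ∃ f : Space N → ℝ, IsRadial f ∧ u =ᵐ[volume] f}

/-- `‖u‖_E = (∫ |∇u|² + D(u²,u²)^{1/2})^{1/2}`. Both energies are finite on `E`. -/
noncomputable def normE {N : ℕ} (u : Space N →ₘ[volume] ℝ) : ℝ :=
  Real.sqrt ((gradEnergy u).toReal + Real.sqrt (coulombEnergy u).toReal)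

/-- The classes of the functions in `C_0^∞(ℝ^N)`. -/
def testClasses (N : ℕ) : Set (Space N →ₘ[volume] ℝ) :=
  {u | ∃ φ : Space N → ℝ, IsTestFunction φ ∧ u =ᵐ[volume] φ}

/-- The classes of the radial functions in `C_0^∞(ℝ^N)`. -/
def radialTestClasses (N : ℕ) : Set (Space N →ₘ[volume] ℝ) :=
  {u | ∃ φ : Space N → ℝ, IsTestFunction φ ∧ IsRadial φ ∧ u =ᵐ[volume] φ}

/-!
By subordination, the Riesz kernel `‖x - y‖ ^ (2 - N)` is a superposition of products of Gaussians
`exp (-2t ‖z - x‖²) exp (-2t ‖z - y‖²)` over `t > 0` and `z`. Hence `b(u) = D(u²,u²)^{1/4}` is the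
norm of `u` in a mixed Lebesgue space `L⁴(L²)`, which gives both the triangle inequality and the
Clarkson inequality `b(u + v)⁴ + b(u - v)⁴ ≤ 8 (b(u)⁴ + b(v)⁴)`. Since `‖u‖_E² = ‖∇u‖₂² + b(u)²`,
the parallelogram law for the gradients and the Clarkson inequality for `b` yield uniform convexity.
Completeness follows from the Sobolev inequality and Fatou's lemma. For the density, `u ∈ E` is
approximated by cutoffs of its mollifications: neither operation increases `D(u²,u²)`, by
translation invariance and Jensen's inequality in `L⁴(L²)`, so that the Clarkson inequality and
Fatou's lemma turn convergence almost everywhere into convergence for `b`.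
-/

open scoped Topology Convolution

section UniformConvexity

variable {V H : Type*} [SeminormedAddCommGroup V] [NormedAddCommGroup H] [InnerProductSpace ℝ H]
  {T : V →+ H} {b : AddGroupSeminorm V}

theorem sub_pow_four_le_of_clarkson
    (clarkson : ∀ u v, b (u + v) ^ 4 + b (u - v) ^ 4 ≤ 8 * (b u ^ 4 + b v ^ 4)) {x y : V}
    (hx : b x ≤ 1) (hy : b y ≤ 1) :
    b (x - y) ^ 4 ≤ 24 * (2 * (b x ^ 2 + b y ^ 2) - b (x + y) ^ 2) := by
  have hx0 := apply_nonneg b x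
  have hy0 := apply_nonneg b y
  have hadd : b (x + y) ^ 2 ≤ (b x + b y) ^ 2 :=
    pow_le_pow_left₀ (apply_nonneg b _) (map_add_le_add b x y) 2
  set s := 2 * (b x ^ 2 + b y ^ 2)
  have hdiff : (b x - b y) ^ 2 ≤ s - b (x + y) ^ 2 := by linarith
  have hgap : 0 ≤ s - b (x + y) ^ 2 := (sq_nonneg _).trans hdiff
  have hs4 : s ≤ 4 := by nlinarith
  have hsum : (b x + b y) ^ 2 ≤ 4 := by nlinarith
  calc b (x - y) ^ 4
      ≤ (s + b (x + y) ^ 2) * (s - b (x + y) ^ 2) + 4 * ((b x - b y) ^ 2 * (b x + b y) ^ 2) := by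
        linarith [clarkson x y]
    _ ≤ 8 * (s - b (x + y) ^ 2) + 4 * ((s - b (x + y) ^ 2) * 4) := by
        gcongr
        linarith
    _ = 24 * (s - b (x + y) ^ 2) := by ring

theorem norm_add_sq_le_of_clarkson (hnorm : ∀ u, ‖u‖ ^ 2 = ‖T u‖ ^ 2 + b u ^ 2)
    (clarkson : ∀ u v, b (u + v) ^ 4 + b (u - v) ^ 4 ≤ 8 * (b u ^ 4 + b v ^ 4)) {x y : V}
    (hx : ‖x‖ = 1) (hy : ‖y‖ = 1) :
    ‖x + y‖ ^ 2 ≤ 4 - (‖T (x - y)‖ ^ 2 + b (x - y) ^ 4 / 24) := by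
  have hle {u : V} (hu : ‖u‖ = 1) : b u ≤ 1 :=
    (sq_le_one_iff₀ (apply_nonneg b u)).1 (by nlinarith [hnorm u, sq_nonneg ‖T u‖])
  have hpar := parallelogram_law_with_norm ℝ (T x) (T y)
  have hb := sub_pow_four_le_of_clarkson clarkson (hle hx) (hle hy)
  have hnx := hnorm x
  have hny := hnorm y
  rw [hx] at hnx
  rw [hy] at hny
  rw [hnorm, map_add, map_sub]
  linarith

theorem uniformConvexSpace_of_clarkson (hnorm : ∀ u, ‖u‖ ^ 2 = ‖T u‖ ^ 2 + b u ^ 2)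
    (clarkson : ∀ u v, b (u + v) ^ 4 + b (u - v) ^ 4 ≤ 8 * (b u ^ 4 + b v ^ 4)) :
    UniformConvexSpace V := by
  refine ⟨fun ε hε => ?_⟩
  set m : ℝ := min (ε ^ 2 / 2) (ε ^ 4 / 96)
  have hm : 0 < m := by positivity
  refine ⟨m / 4, div_pos hm four_pos, fun x hx y hy hxy => ?_⟩
  have hsep : ε ^ 2 ≤ ‖T (x - y)‖ ^ 2 + b (x - y) ^ 2 := by
    rw [← hnorm]
    gcongr
  have hloss : m ≤ ‖T (x - y)‖ ^ 2 + b (x - y) ^ 4 / 24 := by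
    rcases le_total (ε ^ 2 / 2) (‖T (x - y)‖ ^ 2) with h | h
    · exact (min_le_left _ _).trans (h.trans (le_add_of_nonneg_right (by positivity)))
    · have hb : ε ^ 2 / 2 ≤ b (x - y) ^ 2 := by linarith
      have := pow_le_pow_left₀ (by positivity) hb 2
      exact (min_le_right _ _).trans (by nlinarith [sq_nonneg ‖T (x - y)‖])
  have hsum := norm_add_sq_le_of_clarkson hnorm clarkson hx hy
  have hm4 : m ≤ 4 := by linarith [sq_nonneg ‖x + y‖]
  exact (abs_le_of_sq_le_sq' (by linarith [sq_nonneg m]) (by linarith)).2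

end UniformConvexity

theorem sqrt_add_sq_le {a b a₁ b₁ a₂ b₂ : ℝ} (ha : 0 ≤ a) (hb : 0 ≤ b)
    (hA : a ≤ a₁ + a₂) (hB : b ≤ b₁ + b₂) :
    √(a ^ 2 + b ^ 2) ≤ √(a₁ ^ 2 + b₁ ^ 2) + √(a₂ ^ 2 + b₂ ^ 2) := by
  have hmink := norm_add_le (⟨a₁, b₁⟩ : ℂ) ⟨a₂, b₂⟩
  simp only [Complex.norm_eq_sqrt_sq_add_sq, Complex.add_re, Complex.add_im] at hmink
  exact (Real.sqrt_le_sqrt (by gcongr)).trans hmink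

theorem enorm_add_sq_add_enorm_sub_sq {F : Type*} [SeminormedAddCommGroup F]
    [InnerProductSpace ℝ F] (a b : F) :
    ‖a + b‖ₑ ^ 2 + ‖a - b‖ₑ ^ 2 = 2 * (‖a‖ₑ ^ 2 + ‖b‖ₑ ^ 2) := by
  have hpar : ‖a + b‖₊ ^ 2 + ‖a - b‖₊ ^ 2 = 2 * (‖a‖₊ ^ 2 + ‖b‖₊ ^ 2) := by
    ext
    push_cast
    linarith [parallelogram_law_with_norm ℝ a b]
  simp only [enorm_eq_nnnorm]
  exact_mod_cast hpar

theorem ennreal_add_sq_le (a b : ℝ≥0∞) : (a + b) ^ 2 ≤ 2 * (a ^ 2 + b ^ 2) := by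
  have h := ENNReal.rpow_add_le_mul_rpow_add_rpow a b one_le_two
  norm_num at h
  exact h

theorem rpow_lintegral_le_lintegral_rpow {α : Type*} [MeasurableSpace α] {μ : Measure α}
    [IsProbabilityMeasure μ] {f : α → ℝ≥0∞} (hf : AEMeasurable f μ) {p : ℝ} (hp : 1 ≤ p) :
    (∫⁻ x, f x ∂μ) ^ p ≤ ∫⁻ x, f x ^ p ∂μ := by
  have h := eLpNorm'_le_eLpNorm'_of_exponent_le zero_lt_one hp μ hf.aestronglyMeasurable
  simp only [eLpNorm', enorm_eq_self, ENNReal.rpow_one, div_one] at h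
  rwa [one_div, ENNReal.le_rpow_inv_iff (zero_lt_one.trans_le hp)] at h

section MixedEnergy

variable {W X F : Type*} [MeasurableSpace W] [MeasurableSpace X]

/-- The fourth power of the norm of `u` in the mixed Lebesgue space `L⁴(ν; L²(κ))`, where the
inner measure `κ w` depends on the outer variable `w`. -/
noncomputable def mixedEnergy [ENorm F] (κ : ProbabilityTheory.Kernel W X) (ν : Measure W)
    (u : X → F) : ℝ≥0∞ :=
  ∫⁻ w, (∫⁻ x, ‖u x‖ₑ ^ 2 ∂κ w) ^ 2 ∂ν

variable [NormedAddCommGroup F] {κ : ProbabilityTheory.Kernel W X} {ν : Measure W} {u v : X → F}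

theorem mixedEnergy_add_add_sub_le [InnerProductSpace ℝ F] (hu : StronglyMeasurable u)
    (hv : StronglyMeasurable v) :
    mixedEnergy κ ν (u + v) + mixedEnergy κ ν (u - v) ≤
      8 * (mixedEnergy κ ν u + mixedEnergy κ ν v) := by
  set Q : (X → F) → W → ℝ≥0∞ := fun f w => ∫⁻ x, ‖f x‖ₑ ^ 2 ∂κ w
  have hQ {f : X → F} (hf : StronglyMeasurable f) : Measurable fun w => Q f w ^ 2 :=
    (hf.enorm.pow_const 2).lintegral_kernel.pow_const 2
  have parallelogram (w : W) : Q (u + v) w + Q (u - v) w = 2 * (Q u w + Q v w) := by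
    rw [← lintegral_add_left ((hu.add hv).enorm.pow_const 2),
      ← lintegral_add_left (hu.enorm.pow_const 2), ← lintegral_const_mul' _ _ ENNReal.ofNat_ne_top]
    exact lintegral_congr fun x => enorm_add_sq_add_enorm_sub_sq _ _
  calc ∫⁻ w, Q (u + v) w ^ 2 ∂ν + ∫⁻ w, Q (u - v) w ^ 2 ∂ν
      = ∫⁻ w, (Q (u + v) w ^ 2 + Q (u - v) w ^ 2) ∂ν :=
        (lintegral_add_left (hQ (hu.add hv)) _).symm
    _ ≤ ∫⁻ w, 8 * (Q u w ^ 2 + Q v w ^ 2) ∂ν := lintegral_mono fun w => by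
        calc Q (u + v) w ^ 2 + Q (u - v) w ^ 2 ≤ (Q (u + v) w + Q (u - v) w) ^ 2 := by
              rw [add_sq]
              gcongr
              exact le_self_add
          _ = 4 * (Q u w + Q v w) ^ 2 := by
              rw [parallelogram]
              ring
          _ ≤ 4 * (2 * (Q u w ^ 2 + Q v w ^ 2)) := by
              gcongr
              exact ennreal_add_sq_le _ _
          _ = 8 * (Q u w ^ 2 + Q v w ^ 2) := by ring
    _ = 8 * (mixedEnergy κ ν u + mixedEnergy κ ν v) := by
        rw [lintegral_const_mul' _ _ ENNReal.ofNat_ne_top, lintegral_add_left (hQ hu)]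
        rfl

theorem mixedEnergy_eq_lintegral_eLpNorm (u : X → F) :
    mixedEnergy κ ν u = ∫⁻ w, eLpNorm u 2 (κ w) ^ (4 : ℝ) ∂ν := by
  refine lintegral_congr fun w => ?_
  rw [eLpNorm_eq_lintegral_rpow_enorm_toReal two_ne_zero ENNReal.ofNat_ne_top,
    ← ENNReal.rpow_mul, ← ENNReal.rpow_natCast]
  norm_num

theorem measurable_eLpNorm_two_kernel (hu : StronglyMeasurable u) :
    Measurable fun w => eLpNorm u 2 (κ w) := by
  simp only [eLpNorm_eq_lintegral_rpow_enorm_toReal two_ne_zero ENNReal.ofNat_ne_top]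
  exact (hu.enorm.pow_const _).lintegral_kernel.pow_const _

theorem mixedEnergy_add_rpow_le (hu : StronglyMeasurable u) (hv : StronglyMeasurable v) :
    mixedEnergy κ ν (u + v) ^ (1 / 4 : ℝ) ≤
      mixedEnergy κ ν u ^ (1 / 4 : ℝ) + mixedEnergy κ ν v ^ (1 / 4 : ℝ) := by
  simp only [mixedEnergy_eq_lintegral_eLpNorm]
  calc (∫⁻ w, eLpNorm (u + v) 2 (κ w) ^ (4 : ℝ) ∂ν) ^ (1 / 4 : ℝ)
      ≤ (∫⁻ w, (eLpNorm u 2 (κ w) + eLpNorm v 2 (κ w)) ^ (4 : ℝ) ∂ν) ^ (1 / 4 : ℝ) := by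
        gcongr with w
        exact eLpNorm_add_le hu.aestronglyMeasurable hv.aestronglyMeasurable one_le_two
    _ ≤ (∫⁻ w, eLpNorm u 2 (κ w) ^ (4 : ℝ) ∂ν) ^ (1 / 4 : ℝ) +
          (∫⁻ w, eLpNorm v 2 (κ w) ^ (4 : ℝ) ∂ν) ^ (1 / 4 : ℝ) :=
        ENNReal.lintegral_Lp_add_le (measurable_eLpNorm_two_kernel hu).aemeasurable
          (measurable_eLpNorm_two_kernel hv).aemeasurable (by norm_num)

theorem mixedEnergy_le_lintegral {Y G : Type*} [MeasurableSpace Y] [NormedAddCommGroup G]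
    [ProbabilityTheory.IsSFiniteKernel κ] [SFinite ν] {ρ : Measure Y} [IsProbabilityMeasure ρ]
    {U : Y → X → G} (hU : StronglyMeasurable (Function.uncurry U))
    (h : ∀ x, ‖v x‖ₑ ^ 2 ≤ ∫⁻ y, ‖U y x‖ₑ ^ 2 ∂ρ) :
    mixedEnergy κ ν v ≤ ∫⁻ y, mixedEnergy κ ν (U y) ∂ρ := by
  have hU2 : Measurable fun p : Y × X => ‖U p.1 p.2‖ₑ ^ 2 := hU.enorm.pow_const 2
  have hQ : Measurable fun p : W × Y => ∫⁻ x, ‖U p.2 x‖ₑ ^ 2 ∂κ p.1 :=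
    Measurable.lintegral_kernel_prod_right (κ := κ.comap Prod.fst measurable_fst)
      (f := fun (p : W × Y) x => ‖U p.2 x‖ₑ ^ 2)
      (hU2.comp ((measurable_snd.comp measurable_fst).prodMk measurable_snd))
  have hinner (w : W) : ∫⁻ x, ‖v x‖ₑ ^ 2 ∂κ w ≤ ∫⁻ y, ∫⁻ x, ‖U y x‖ₑ ^ 2 ∂κ w ∂ρ :=
    (lintegral_mono h).trans_eq (lintegral_lintegral_swap (hU2.comp measurable_swap).aemeasurable)
  calc mixedEnergy κ ν v ≤ ∫⁻ w, (∫⁻ y, ∫⁻ x, ‖U y x‖ₑ ^ 2 ∂κ w ∂ρ) ^ 2 ∂ν :=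
        lintegral_mono fun w => pow_le_pow_left₀ zero_le (hinner w) 2
    _ ≤ ∫⁻ w, ∫⁻ y, (∫⁻ x, ‖U y x‖ₑ ^ 2 ∂κ w) ^ 2 ∂ρ ∂ν := lintegral_mono fun w => by
        simpa using rpow_lintegral_le_lintegral_rpow (μ := ρ)
          (hQ.comp measurable_prodMk_left).aemeasurable one_le_two
    _ = ∫⁻ y, mixedEnergy κ ν (U y) ∂ρ :=
        lintegral_lintegral_swap (hQ.pow_const 2).aemeasurable

end MixedEnergy

section RieszKernel

variable (E : Type*) [NormedAddCommGroup E] [InnerProductSpace ℝ E] [FiniteDimensional ℝ E]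
  [MeasurableSpace E] [BorelSpace E]

/-- The kernel sending `(t, z)` to the Gaussian measure `exp (-2t ‖z - x‖²) dx`. -/
noncomputable def gaussianKernel : ProbabilityTheory.Kernel (ℝ × E) E :=
  (ProbabilityTheory.Kernel.const (ℝ × E) volume).withDensity
    fun w x => ENNReal.ofReal (Real.exp (-(2 * w.1) * ‖w.2 - x‖ ^ 2))

instance : ProbabilityTheory.IsSFiniteKernel (gaussianKernel E) :=
  ProbabilityTheory.Kernel.IsSFiniteKernel.withDensity _ fun _ _ => ENNReal.ofReal_ne_top

/-- The measure on the parameters of `gaussianKernel E` for which the autocorrelations of the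
Gaussians integrate to the Riesz kernel `‖x - y‖ ^ (-2a)`: the factor `(4t / π) ^ (d / 2)`, with
`d = dim E`, normalizes the autocorrelations to `exp (-t ‖x - y‖²)`, and then
`∫ exp (-t r²) t ^ (a - 1) dt = Γ(a) r ^ (-2a)`. -/
noncomputable def rieszMeasure (a : ℝ) : Measure (ℝ × E) :=
  ((volume.restrict (Set.Ioi 0)).withDensity fun t => ENNReal.ofReal
    ((4 * t / Real.pi) ^ ((Module.finrank ℝ E : ℝ) / 2) * t ^ (a - 1) / Real.Gamma a)).prod volume

instance (a : ℝ) : SFinite (rieszMeasure E a) := by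
  unfold rieszMeasure
  infer_instance

variable {E}

theorem lintegral_gaussianKernel (w : ℝ × E) {f : E → ℝ≥0∞} (hf : Measurable f) :
    ∫⁻ x, f x ∂gaussianKernel E w =
      ∫⁻ x, ENNReal.ofReal (Real.exp (-(2 * w.1) * ‖w.2 - x‖ ^ 2)) * f x := by
  rw [gaussianKernel, ProbabilityTheory.Kernel.lintegral_withDensity _ (by fun_prop) _ hf,
    ProbabilityTheory.Kernel.const_apply]

theorem lintegral_exp_neg_mul_norm_sub_sq {b : ℝ} (hb : 0 < b) (c : E) :
    ∫⁻ z : E, ENNReal.ofReal (Real.exp (-b * ‖z - c‖ ^ 2)) =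
      ENNReal.ofReal ((Real.pi / b) ^ ((Module.finrank ℝ E : ℝ) / 2)) := by
  have hint := GaussianFourier.integral_rexp_neg_mul_sq_norm (V := E) hb
  have hpos : (0 : ℝ) < (Real.pi / b) ^ ((Module.finrank ℝ E : ℝ) / 2) := by positivity
  rw [lintegral_sub_right_eq_self (fun z : E => ENNReal.ofReal (Real.exp (-b * ‖z‖ ^ 2))), ← hint,
    ofReal_integral_eq_lintegral_ofReal]
  · exact Integrable.of_integral_ne_zero (hint ▸ hpos.ne')
  · exact Eventually.of_forall fun _ => (Real.exp_pos _).le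

theorem lintegral_exp_mul_exp {t : ℝ} (ht : 0 < t) (x y : E) :
    ∫⁻ z : E, ENNReal.ofReal (Real.exp (-(2 * t) * ‖z - x‖ ^ 2)) *
        ENNReal.ofReal (Real.exp (-(2 * t) * ‖z - y‖ ^ 2)) =
      ENNReal.ofReal ((Real.pi / (4 * t)) ^ ((Module.finrank ℝ E : ℝ) / 2) *
        Real.exp (-(‖x - y‖ ^ 2 * t))) := by
  have hmidpoint (z : E) : ENNReal.ofReal (Real.exp (-(2 * t) * ‖z - x‖ ^ 2)) *
        ENNReal.ofReal (Real.exp (-(2 * t) * ‖z - y‖ ^ 2)) =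
      ENNReal.ofReal (Real.exp (-(4 * t) * ‖z - midpoint ℝ x y‖ ^ 2)) *
        ENNReal.ofReal (Real.exp (-(‖x - y‖ ^ 2 * t))) := by
    simp only [← ENNReal.ofReal_mul (Real.exp_pos _).le, ← Real.exp_add]
    have h := parallelogram_law_with_norm ℝ (z - midpoint ℝ x y) ((2⁻¹ : ℝ) • (x - y))
    rw [midpoint_eq_smul_add, invOf_eq_inv] at h ⊢
    rw [show z - (2⁻¹ : ℝ) • (x + y) + (2⁻¹ : ℝ) • (x - y) = z - y by module,
      show z - (2⁻¹ : ℝ) • (x + y) - (2⁻¹ : ℝ) • (x - y) = z - x by module,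
      norm_smul, Real.norm_of_nonneg (by norm_num : (0 : ℝ) ≤ 2⁻¹)] at h
    congr 2
    linear_combination (-(2 * t)) * h
  simp only [hmidpoint]
  rw [lintegral_mul_const' _ _ ENNReal.ofReal_ne_top,
    lintegral_exp_neg_mul_norm_sub_sq (by positivity), ← ENNReal.ofReal_mul (by positivity)]

theorem lintegral_rpow_mul_exp_neg_mul {a r : ℝ} (ha : 0 < a) (hr : 0 < r) :
    ∫⁻ t in Set.Ioi (0 : ℝ), ENNReal.ofReal (t ^ (a - 1) / Real.Gamma a * Real.exp (-(r * t))) =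
      ENNReal.ofReal (1 / r ^ a) := by
  have hG := Real.Gamma_pos_of_pos ha
  have hint : ∫ t in Set.Ioi (0 : ℝ), t ^ (a - 1) / Real.Gamma a * Real.exp (-(r * t)) =
      1 / r ^ a := by
    simp only [div_mul_eq_mul_div]
    rw [integral_div, Real.integral_rpow_mul_exp_neg_mul_Ioi ha hr, mul_div_cancel_right₀ _ hG.ne',
      Real.div_rpow zero_le_one hr.le, Real.one_rpow]
  rw [← hint, ofReal_integral_eq_lintegral_ofReal]
  · have : 0 < 1 / r ^ a := by positivity
    exact Integrable.of_integral_ne_zero (hint ▸ this.ne')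
  · filter_upwards [ae_restrict_mem measurableSet_Ioi] with t (ht : 0 < t)
    positivity

theorem lintegral_rieszMeasure_gaussian {a : ℝ} (ha : 0 < a) {x y : E} (hxy : x ≠ y) :
    ∫⁻ w, ENNReal.ofReal (Real.exp (-(2 * w.1) * ‖w.2 - x‖ ^ 2)) *
        ENNReal.ofReal (Real.exp (-(2 * w.1) * ‖w.2 - y‖ ^ 2)) ∂rieszMeasure E a =
      ENNReal.ofReal (1 / ‖x - y‖ ^ (2 * a)) := by
  have hr : 0 < ‖x - y‖ ^ 2 := by
    have := norm_pos_iff.2 (sub_ne_zero.2 hxy)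
    positivity
  rw [rieszMeasure, lintegral_prod _ (by fun_prop),
    lintegral_withDensity_eq_lintegral_mul _ (by fun_prop) (by fun_prop),
    Real.rpow_mul (norm_nonneg _), Real.rpow_two, ← lintegral_rpow_mul_exp_neg_mul ha hr]
  refine setLIntegral_congr_fun measurableSet_Ioi fun t (ht : 0 < t) => ?_
  simp only [Pi.mul_apply]
  rw [lintegral_exp_mul_exp ht, ← ENNReal.ofReal_mul (by positivity)]
  have hcancel : (4 * t / Real.pi) ^ ((Module.finrank ℝ E : ℝ) / 2) *
      (Real.pi / (4 * t)) ^ ((Module.finrank ℝ E : ℝ) / 2) = 1 := by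
    rw [← Real.mul_rpow (by positivity) (by positivity), div_mul_div_cancel₀ Real.pi_ne_zero,
      div_self (by positivity), Real.one_rpow]
  congr 1
  linear_combination (t ^ (a - 1) / Real.Gamma a * Real.exp (-(‖x - y‖ ^ 2 * t))) * hcancel

theorem mixedEnergy_gaussianKernel_rieszMeasure [Nontrivial E] {F : Type*}
    [NormedAddCommGroup F] {a : ℝ} (ha : 0 < a) {u : E → F} (hu : StronglyMeasurable u) :
    mixedEnergy (gaussianKernel E) (rieszMeasure E a) u =
      ∫⁻ x, ∫⁻ y, ‖u x‖ₑ ^ 2 * ‖u y‖ₑ ^ 2 * ENNReal.ofReal (1 / ‖x - y‖ ^ (2 * a)) := by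
  have hu2 : Measurable fun x => ‖u x‖ₑ ^ 2 := hu.enorm.pow_const 2
  set g : ℝ × E → E → ℝ≥0∞ := fun w x => ENNReal.ofReal (Real.exp (-(2 * w.1) * ‖w.2 - x‖ ^ 2))
  have hsq (w : ℝ × E) : (∫⁻ x, ‖u x‖ₑ ^ 2 ∂gaussianKernel E w) ^ 2 =
      ∫⁻ x, ∫⁻ y, ‖u x‖ₑ ^ 2 * ‖u y‖ₑ ^ 2 * (g w x * g w y) := by
    rw [sq, lintegral_gaussianKernel w hu2,
      ← lintegral_lintegral_mul (by fun_prop) (by fun_prop)]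
    refine lintegral_congr fun x => lintegral_congr fun y => ?_
    ring
  rw [mixedEnergy, lintegral_congr hsq, lintegral_lintegral_swap]
  · refine lintegral_congr fun x => ?_
    rw [lintegral_lintegral_swap (by fun_prop)]
    refine lintegral_congr_ae ?_
    filter_upwards [Measure.ae_ne volume x] with y hy
    rw [lintegral_const_mul _ (by fun_prop), lintegral_rieszMeasure_gaussian ha hy.symm]
  · refine (Measurable.lintegral_prod_right' (f := fun p : ((ℝ × E) × E) × E =>
      ‖u p.1.2‖ₑ ^ 2 * ‖u p.2‖ₑ ^ 2 * (g p.1.1 p.1.2 * g p.1.1 p.2)) ?_).aemeasurable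
    fun_prop

end RieszKernel

theorem tendsto_zero_of_add_le_of_le_liminf {c s : ℕ → ℝ≥0∞} {K : ℝ≥0∞} (hK : K ≠ ⊤)
    (h : ∀ n, c n + s n ≤ K) (hs : K ≤ liminf s atTop) : Tendsto c atTop (𝓝 0) := by
  have hsK (n : ℕ) : s n ≤ K := le_add_self.trans (h n)
  have hlim : Tendsto s atTop (𝓝 K) := tendsto_of_le_liminf_of_limsup_le hs
    (limsup_le_of_le (by isBoundedDefault) (Eventually.of_forall hsK))
  have hsub : Tendsto (fun n => K - s n) atTop (𝓝 0) := by
    simpa using ENNReal.Tendsto.sub tendsto_const_nhds hlim (Or.inl hK)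
  exact tendsto_of_tendsto_of_tendsto_of_le_of_le tendsto_const_nhds hsub (fun _ => zero_le)
    fun n => ENNReal.le_sub_of_add_le_right (ne_top_of_le_ne_top hK (hsK n)) (h n)

section CoulombEnergy

variable {N : ℕ} {u v : Space N → ℝ}

theorem coulombEnergy_eq_lintegral_enorm (u : Space N → ℝ) :
    coulombEnergy u = ∫⁻ x, ∫⁻ y, ‖u x‖ₑ ^ 2 * ‖u y‖ₑ ^ 2 *
      ENNReal.ofReal (1 / ‖x - y‖ ^ (N - 2)) := by
  refine lintegral_congr fun x => lintegral_congr fun y => ?_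
  rw [div_eq_mul_one_div, ENNReal.ofReal_mul (by positivity), ENNReal.ofReal_mul (by positivity),
    ← sq_abs (u x), ← sq_abs (u y), ENNReal.ofReal_pow (abs_nonneg _),
    ENNReal.ofReal_pow (abs_nonneg _), Real.enorm_eq_ofReal_abs, Real.enorm_eq_ofReal_abs]

theorem coulombEnergy_eq_mixedEnergy (hN : 3 ≤ N) (hu : Measurable u) :
    coulombEnergy u =
      mixedEnergy (gaussianKernel (Space N)) (rieszMeasure (Space N) ((N - 2 : ℝ) / 2)) u := by
  have : Nonempty (Fin N) := ⟨⟨0, by omega⟩⟩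
  have hexp : 2 * ((N - 2 : ℝ) / 2) = (N - 2 : ℕ) := by
    push_cast [show 2 ≤ N by omega]
    ring
  have hpos : (0 : ℝ) < (N - 2 : ℝ) / 2 := by
    have : (3 : ℝ) ≤ N := by exact_mod_cast hN
    linarith
  rw [mixedEnergy_gaussianKernel_rieszMeasure hpos hu.stronglyMeasurable, hexp]
  simp only [Real.rpow_natCast]
  exact coulombEnergy_eq_lintegral_enorm u

theorem coulombEnergy_mono (h : ∀ᵐ x, ‖u x‖ ≤ ‖v x‖) : coulombEnergy u ≤ coulombEnergy v := by
  simp only [coulombEnergy_eq_lintegral_enorm]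
  refine lintegral_mono_ae ?_
  filter_upwards [h] with x hx
  refine lintegral_mono_ae ?_
  filter_upwards [h] with y hy
  gcongr <;> exact enorm_le_iff_norm_le.2 ‹_›

theorem coulombEnergy_congr_norm (h : ∀ᵐ x, ‖u x‖ = ‖v x‖) : coulombEnergy u = coulombEnergy v :=
  le_antisymm (coulombEnergy_mono (h.mono fun _ hx => hx.le))
    (coulombEnergy_mono (h.mono fun _ hx => hx.ge))

theorem coulombEnergy_congr (h : u =ᵐ[volume] v) : coulombEnergy u = coulombEnergy v :=
  coulombEnergy_congr_norm (h.mono fun _ hx => congrArg norm hx)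

theorem coulombEnergy_const_smul (c : ℝ) (u : Space N → ℝ) :
    coulombEnergy (c • u) = ‖c‖ₑ ^ 4 * coulombEnergy u := by
  have hc : ‖c‖ₑ ^ 4 ≠ ⊤ := ENNReal.pow_ne_top enorm_ne_top
  simp only [coulombEnergy_eq_lintegral_enorm, ← lintegral_const_mul' _ _ hc]
  refine lintegral_congr fun x => lintegral_congr fun y => ?_
  simp only [Pi.smul_apply, enorm_smul]
  ring

theorem coulombEnergy_comp_sub_right (u : Space N → ℝ) (a : Space N) :
    coulombEnergy (fun x => u (x - a)) = coulombEnergy u := by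
  set G : Space N → ℝ≥0∞ := fun x => ∫⁻ y, ENNReal.ofReal (u x ^ 2 * u y ^ 2 / ‖x - y‖ ^ (N - 2))
  have hinner (x : Space N) :
      ∫⁻ y, ENNReal.ofReal (u (x - a) ^ 2 * u (y - a) ^ 2 / ‖x - y‖ ^ (N - 2)) = G (x - a) := by
    simpa only [sub_sub_sub_cancel_right] using lintegral_sub_right_eq_self
      (fun y => ENNReal.ofReal (u (x - a) ^ 2 * u y ^ 2 / ‖x - a - y‖ ^ (N - 2))) a
  exact (lintegral_congr hinner).trans (lintegral_sub_right_eq_self G a)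

theorem coulombEnergy_add_add_sub_le (hN : 3 ≤ N) (hu : Measurable u) (hv : Measurable v) :
    coulombEnergy (u + v) + coulombEnergy (u - v) ≤ 8 * (coulombEnergy u + coulombEnergy v) := by
  simp only [coulombEnergy_eq_mixedEnergy hN, hu, hv, hu.add hv, hu.sub hv]
  exact mixedEnergy_add_add_sub_le hu.stronglyMeasurable hv.stronglyMeasurable

theorem coulombEnergy_add_rpow_le (hN : 3 ≤ N) (hu : Measurable u) (hv : Measurable v) :
    coulombEnergy (u + v) ^ (1 / 4 : ℝ) ≤
      coulombEnergy u ^ (1 / 4 : ℝ) + coulombEnergy v ^ (1 / 4 : ℝ) := by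
  simp only [coulombEnergy_eq_mixedEnergy hN, hu, hv, hu.add hv]
  exact mixedEnergy_add_rpow_le hu.stronglyMeasurable hv.stronglyMeasurable

theorem coulombEnergy_le_of_average (hN : 3 ≤ N) {ρ : Measure (Space N)} [IsProbabilityMeasure ρ]
    (hu : Measurable u) (hv : Measurable v)
    (h : ∀ x, ‖v x‖ₑ ^ 2 ≤ ∫⁻ y, ‖u (x - y)‖ₑ ^ 2 ∂ρ) : coulombEnergy v ≤ coulombEnergy u := by
  have htranslate (y : Space N) : Measurable fun x => u (x - y) := by fun_prop
  calc coulombEnergy v ≤ ∫⁻ y, coulombEnergy (fun x => u (x - y)) ∂ρ := by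
        simp only [coulombEnergy_eq_mixedEnergy hN, hv, htranslate]
        refine mixedEnergy_le_lintegral (U := fun y x => u (x - y))
          (Measurable.stronglyMeasurable ?_) h
        exact hu.comp (measurable_snd.sub measurable_fst)
    _ = coulombEnergy u := by simp only [coulombEnergy_comp_sub_right, lintegral_const,
        measure_univ, mul_one]

theorem coulombEnergy_le_liminf {v : ℕ → Space N → ℝ} (hv : ∀ n, Measurable (v n))
    (h : ∀ᵐ x, Tendsto (fun n => v n x) atTop (𝓝 (u x))) :
    coulombEnergy u ≤ liminf (fun n => coulombEnergy (v n)) atTop := by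
  have hm (n : ℕ) : Measurable fun p : Space N × Space N =>
      ENNReal.ofReal (v n p.1 ^ 2 * v n p.2 ^ 2 / ‖p.1 - p.2‖ ^ (N - 2)) := by
    have := hv n
    fun_prop
  refine le_trans (lintegral_mono_ae ?_)
    (lintegral_liminf_le fun n => (hm n).lintegral_prod_right)
  filter_upwards [h] with x hx
  refine le_trans (lintegral_mono_ae ?_)
    (lintegral_liminf_le fun n => (hm n).comp measurable_prodMk_left)
  filter_upwards [h] with y hy
  exact (ENNReal.tendsto_ofReal (((hx.pow 2).mul (hy.pow 2)).div_const _)).liminf_eq.ge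

/-- The Radon–Riesz property: Clarkson's inequality forces `v n - u` to be small, because
`coulombEnergy (v n + u)` has a liminf of at least `coulombEnergy (2 • u)`. -/
theorem tendsto_coulombEnergy_sub (hN : 3 ≤ N) {v : ℕ → Space N → ℝ}
    (hv : ∀ n, Measurable (v n)) (hu : Measurable u) (hfin : coulombEnergy u ≠ ⊤)
    (hle : ∀ n, coulombEnergy (v n) ≤ coulombEnergy u)
    (h : ∀ᵐ x, Tendsto (fun n => v n x) atTop (𝓝 (u x))) :
    Tendsto (fun n => coulombEnergy (v n - u)) atTop (𝓝 0) := by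
  have htwo : coulombEnergy ((2 : ℝ) • u) = 16 * coulombEnergy u := by
    rw [coulombEnergy_const_smul, Real.enorm_eq_ofReal zero_le_two, ENNReal.ofReal_ofNat]
    norm_num
  refine tendsto_zero_of_add_le_of_le_liminf (s := fun n => coulombEnergy (v n + u))
    (K := 16 * coulombEnergy u) (ENNReal.mul_ne_top ENNReal.ofNat_ne_top hfin) (fun n => ?_) ?_
  · calc coulombEnergy (v n - u) + coulombEnergy (v n + u)
        ≤ 8 * (coulombEnergy (v n) + coulombEnergy u) := by
          rw [add_comm]
          exact coulombEnergy_add_add_sub_le hN (hv n) hu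
      _ ≤ 8 * (coulombEnergy u + coulombEnergy u) := by gcongr; exact hle n
      _ = 16 * coulombEnergy u := by ring
  · rw [← htwo, two_smul]
    exact coulombEnergy_le_liminf (fun n => (hv n).add hu) (h.mono fun x hx => hx.add_const _)

theorem setLIntegral_ball_one_div_norm_pow_lt_top (hN : N ≠ 0) (R : ℝ) :
    ∫⁻ z : Space N in Metric.ball 0 R, ENNReal.ofReal (1 / ‖z‖ ^ (N - 2)) < ⊤ := by
  refine IntegrableOn.setLIntegral_lt_top (integrableOn_ball_of_norm_le_rpow (C := 1)
    (α := ((N - 2 : ℕ) : ℝ)) ?_ ?_ (Eventually.of_forall fun z => ?_)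
    (Measurable.aestronglyMeasurable (by fun_prop)))
  · rw [finrank_euclideanSpace_fin]
    omega
  · rw [finrank_euclideanSpace_fin]
    exact_mod_cast (by omega : N - 2 < N)
  · rw [Real.norm_of_nonneg (by positivity), Real.rpow_neg (norm_nonneg _), Real.rpow_natCast,
      one_mul, one_div]

theorem coulombEnergy_lt_top_of_bounded (hN : N ≠ 0) {M R : ℝ} (hM : ∀ x, ‖u x‖ ≤ M)
    (hR : ∀ x, R < ‖x‖ → u x = 0) : coulombEnergy u < ⊤ := by
  set K : Space N → ℝ≥0∞ := fun z => ENNReal.ofReal (1 / ‖z‖ ^ (N - 2))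
  set B := Metric.closedBall (0 : Space N) R
  set D := Metric.ball (0 : Space N) (2 * R + 1)
  have hMe (x : Space N) : ‖u x‖ₑ ≤ ENNReal.ofReal M :=
    (Real.enorm_eq_ofReal_abs _).trans_le (ENNReal.ofReal_le_ofReal (hM x))
  have hpointwise (x y : Space N) : ‖u x‖ₑ ^ 2 * ‖u y‖ₑ ^ 2 * K (x - y) ≤
      B.indicator (fun _ => ENNReal.ofReal M ^ 2 * ENNReal.ofReal M ^ 2) x *
        D.indicator K (x - y) := by
    rcases lt_or_ge R ‖x‖ with hx | hx
    · simp [hR x hx]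
    rcases lt_or_ge R ‖y‖ with hy | hy
    · simp [hR y hy]
    have hxy : x - y ∈ D := by
      rw [mem_ball_zero_iff]
      linarith [norm_sub_le x y]
    rw [Set.indicator_of_mem hxy, Set.indicator_of_mem (by simpa [B] using hx)]
    gcongr <;> exact hMe _
  have hDK : Measurable (D.indicator K) :=
    (by fun_prop : Measurable K).indicator measurableSet_ball
  have hinner (x : Space N) : ∫⁻ y, D.indicator K (x - y) = ∫⁻ z in D, K z := by
    rw [lintegral_sub_left_eq_self, lintegral_indicator measurableSet_ball]
  have hfin : ∫⁻ z in D, K z < ⊤ := setLIntegral_ball_one_div_norm_pow_lt_top hN _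
  calc coulombEnergy u
      ≤ ∫⁻ x, B.indicator (fun _ => ENNReal.ofReal M ^ 2 * ENNReal.ofReal M ^ 2) x *
          ∫⁻ z in D, K z := by
        rw [coulombEnergy_eq_lintegral_enorm]
        refine lintegral_mono fun x => ?_
        rw [← hinner x, ← lintegral_const_mul _ (by fun_prop)]
        exact lintegral_mono (hpointwise x)
    _ = ENNReal.ofReal M ^ 2 * ENNReal.ofReal M ^ 2 * volume B * ∫⁻ z in D, K z := by
        rw [lintegral_mul_const' _ _ hfin.ne, lintegral_indicator_const measurableSet_closedBall]
    _ < ⊤ := ENNReal.mul_lt_top (ENNReal.mul_lt_top (by finiteness) measure_closedBall_lt_top) hfin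

theorem IsTestFunction.coulombEnergy_lt_top (hN : N ≠ 0) (hu : IsTestFunction u) :
    coulombEnergy u < ⊤ := by
  obtain ⟨M, hM⟩ := hu.2.exists_bound_of_continuous hu.1.continuous
  obtain ⟨R, hR⟩ := hu.2.isBounded.subset_closedBall 0
  refine coulombEnergy_lt_top_of_bounded hN hM (R := R) fun x hx => ?_
  exact image_eq_zero_of_notMem_tsupport fun hmem => absurd (hR hmem) (by simpa using hx)

end CoulombEnergy

section Plateau

variable {E : Type*} [NormedAddCommGroup E]

/-- A smooth radial function with values in `[0, 1]`, equal to `1` on the unit ball and supported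
in the ball of radius `2`. It replaces `ContDiffBump`, which is not known to be radial. -/
noncomputable def plateau (x : E) : ℝ := Real.smoothTransition (2 - ‖x‖ ^ 2)

theorem plateau_nonneg (x : E) : 0 ≤ plateau x := Real.smoothTransition.nonneg _

theorem plateau_le_one (x : E) : plateau x ≤ 1 := Real.smoothTransition.le_one _

theorem plateau_eq_one {x : E} (hx : ‖x‖ ≤ 1) : plateau x = 1 :=
  Real.smoothTransition.one_of_one_le (by nlinarith [norm_nonneg x])

theorem plateau_eq_zero {x : E} (hx : 2 ≤ ‖x‖) : plateau x = 0 :=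
  Real.smoothTransition.zero_of_nonpos (by nlinarith)

theorem plateau_smul_congr [NormedSpace ℝ E] (c : ℝ) {x y : E} (h : ‖x‖ = ‖y‖) :
    plateau (c • x) = plateau (c • y) := by
  rw [plateau, plateau, norm_smul, norm_smul, h]

theorem hasCompactSupport_plateau [ProperSpace E] : HasCompactSupport (plateau (E := E)) :=
  HasCompactSupport.intro (isCompact_closedBall 0 2) fun _ hx =>
    plateau_eq_zero (not_le.1 (by simpa using hx)).le

variable [InnerProductSpace ℝ E]

theorem contDiff_plateau : ContDiff ℝ ∞ (plateau (E := E)) :=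
  Real.smoothTransition.contDiff.comp (contDiff_const.sub (contDiff_norm_sq ℝ))

theorem contDiff_plateau_smul (c : ℝ) : ContDiff ℝ ∞ fun x : E => plateau (c • x) :=
  contDiff_plateau.comp (contDiff_const_smul c)

end Plateau

section Mollify

variable {E F : Type*} [NormedAddCommGroup E] [InnerProductSpace ℝ E] [FiniteDimensional ℝ E]
  [MeasurableSpace E] [BorelSpace E] [NormedAddCommGroup F] [NormedSpace ℝ F]

theorem integral_plateau_pos : 0 < ∫ x : E, plateau x :=
  contDiff_plateau.continuous.integral_pos_of_hasCompactSupport_nonneg_nonzero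
    hasCompactSupport_plateau plateau_nonneg (x := 0) (by simp [plateau_eq_one])

/-- Smooth radial functions of integral `1`, supported in the ball of radius `2 / (n + 1)`. -/
noncomputable def mollifier (n : ℕ) (x : E) : ℝ :=
  ((n : ℝ) + 1) ^ Module.finrank ℝ E / (∫ y : E, plateau y) * plateau (((n : ℝ) + 1) • x)

theorem contDiff_mollifier (n : ℕ) : ContDiff ℝ ∞ (mollifier (E := E) n) :=
  contDiff_const.mul (contDiff_plateau_smul _)

theorem hasCompactSupport_mollifier (n : ℕ) : HasCompactSupport (mollifier (E := E) n) :=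
  (hasCompactSupport_plateau.comp_smul (Nat.cast_add_one_ne_zero n)).mul_left

theorem measurable_mollifier (n : ℕ) : Measurable (mollifier (E := E) n) :=
  (contDiff_mollifier n).continuous.measurable

theorem integrable_mollifier (n : ℕ) : Integrable (mollifier (E := E) n) :=
  (contDiff_mollifier n).continuous.integrable_of_hasCompactSupport (hasCompactSupport_mollifier n)

theorem mollifier_nonneg (n : ℕ) (x : E) : 0 ≤ mollifier n x :=
  mul_nonneg (div_nonneg (by positivity) integral_plateau_pos.le) (plateau_nonneg _)

theorem mollifier_le (n : ℕ) (x : E) :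
    mollifier n x ≤ ((n : ℝ) + 1) ^ Module.finrank ℝ E / ∫ y : E, plateau y :=
  mul_le_of_le_one_right (div_nonneg (by positivity) integral_plateau_pos.le) (plateau_le_one _)

theorem mollifier_eq_zero (n : ℕ) {x : E} (h : 2 / ((n : ℝ) + 1) ≤ ‖x‖) : mollifier n x = 0 := by
  rw [mollifier, plateau_eq_zero, mul_zero]
  rw [norm_smul, Real.norm_of_nonneg (by positivity)]
  rwa [div_le_iff₀' (by positivity)] at h

theorem mollifier_congr (n : ℕ) {x y : E} (h : ‖x‖ = ‖y‖) : mollifier n x = mollifier n y := by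
  rw [mollifier, mollifier, plateau_smul_congr _ h]

theorem integral_mollifier (n : ℕ) : ∫ x : E, mollifier n x = 1 := by
  have hpos := integral_plateau_pos (E := E)
  simp only [mollifier]
  rw [integral_const_mul, Measure.integral_comp_smul, smul_eq_mul, abs_of_nonneg (by positivity)]
  field_simp

/-- The convolution of `u` with the `n`-th mollifier. -/
noncomputable def mollify (n : ℕ) (u : E → F) : E → F :=
  mollifier n ⋆[ContinuousLinearMap.lsmul ℝ ℝ, volume] u

theorem mollify_apply (n : ℕ) (u : E → F) (x : E) :
    mollify n u x = ∫ y, mollifier n y • u (x - y) :=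
  rfl

theorem mollify_apply_swap (n : ℕ) (u : E → F) (x : E) :
    mollify n u x = ∫ y, mollifier n (x - y) • u y :=
  convolution_lsmul_swap

theorem contDiff_mollify (n : ℕ) {u : E → F} (hu : LocallyIntegrable u) :
    ContDiff ℝ ∞ (mollify n u) :=
  (hasCompactSupport_mollifier n).contDiff_convolution_left (n := ⊤) _ (contDiff_mollifier n) hu

theorem mollify_congr_ae (n : ℕ) {u v : E → F} (h : u =ᵐ[volume] v) :
    mollify n u = mollify n v := by
  funext x
  simp only [mollify_apply_swap]
  exact integral_congr_ae (h.mono fun y hy => congrArg (mollifier n (x - y) • ·) hy)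

theorem mollify_comp_linearIsometryEquiv (n : ℕ) (u : E → F) (e : E ≃ₗᵢ[ℝ] E) :
    mollify n (u ∘ e) = mollify n u ∘ e := by
  funext x
  calc mollify n (u ∘ e) x = ∫ y, mollifier n (e y) • u (e x - e y) := by
        simp only [mollify_apply, Function.comp_apply, map_sub, mollifier_congr n (e.norm_map _)]
    _ = ∫ y, mollifier n y • u (e x - y) :=
        e.measurePreserving.integral_comp e.toHomeomorph.measurableEmbedding
          fun y => mollifier n y • u (e x - y)

theorem tendsto_two_div_add_one : Tendsto (fun n : ℕ => 2 / ((n : ℝ) + 1)) atTop (𝓝[>] 0) :=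
  tendsto_nhdsWithin_iff.2 ⟨by
    simpa [div_eq_mul_inv] using (tendsto_one_div_add_atTop_nhds_zero_nat (𝕜 := ℝ)).const_mul 2,
    Eventually.of_forall fun n => Set.mem_Ioi.2 (by positivity)⟩

theorem ae_tendsto_mollify [CompleteSpace F] {u : E → F} (hu : LocallyIntegrable u) :
    ∀ᵐ x, Tendsto (fun n => mollify n u x) atTop (𝓝 (u x)) := by
  filter_upwards [(Besicovitch.vitaliFamily volume).ae_tendsto_average_norm_sub hu] with x hx
  have hball := (hx.comp (Besicovitch.tendsto_filterAt volume x)).comp tendsto_two_div_add_one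
  simp only [mollify_apply_swap]
  refine tendsto_integral_smul_of_tendsto_average_norm_sub
    (2 ^ Module.finrank ℝ E * volume.real (Metric.ball (0 : E) 1) / ∫ y : E, plateau y)
    hball ?_ ?_ ?_ ?_
  · exact Eventually.of_forall fun n => hu.integrableOn_isCompact (isCompact_closedBall _ _)
  · refine tendsto_const_nhds.congr fun n => ?_
    rw [integral_sub_left_eq_self (mollifier n) volume x, integral_mollifier]
  · refine Eventually.of_forall fun n => Function.support_subset_iff'.2 fun y hy => ?_
    rw [Metric.mem_closedBall, dist_comm, dist_eq_norm, not_le] at hy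
    exact mollifier_eq_zero n hy.le
  · refine Eventually.of_forall fun n y => ?_
    have hvol : 0 < volume.real (Metric.ball (0 : E) 1) :=
      ENNReal.toReal_pos (Metric.measure_ball_pos _ _ one_pos).ne' measure_ball_lt_top.ne
    rw [abs_of_nonneg (mollifier_nonneg _ _), Measure.addHaar_real_closedBall _ _ (by positivity)]
    refine (mollifier_le n _).trans_eq ?_
    have := integral_plateau_pos (E := E)
    rw [div_pow]
    field_simp

variable (E) in
/-- The probability measure with density `mollifier n`. -/
noncomputable def mollifierMeasure (n : ℕ) : Measure E :=
  volume.withDensity fun y => ENNReal.ofReal (mollifier n y)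

instance (n : ℕ) : IsProbabilityMeasure (mollifierMeasure E n) := by
  refine ⟨?_⟩
  rw [mollifierMeasure, withDensity_apply _ MeasurableSet.univ, Measure.restrict_univ,
    ← ofReal_integral_eq_lintegral_ofReal (integrable_mollifier n)
      (Eventually.of_forall (mollifier_nonneg n)), integral_mollifier, ENNReal.ofReal_one]

theorem ae_norm_le_two_mollifierMeasure (n : ℕ) : ∀ᵐ y ∂mollifierMeasure E n, ‖y‖ ≤ 2 := by
  rw [mollifierMeasure, ae_withDensity_iff (measurable_mollifier n).ennreal_ofReal]
  refine Eventually.of_forall fun y => not_imp_comm.1 fun hy => ?_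
  have hdiv : 2 / ((n : ℝ) + 1) ≤ 2 := div_le_self zero_le_two (by simp)
  rw [mollifier_eq_zero n (hdiv.trans (not_le.1 hy).le), ENNReal.ofReal_zero]

theorem enorm_mollify_rpow_le (n : ℕ) {u : E → F} (hu : StronglyMeasurable u) (x : E) {p : ℝ}
    (hp : 1 ≤ p) : ‖mollify n u x‖ₑ ^ p ≤ ∫⁻ y, ‖u (x - y)‖ₑ ^ p ∂mollifierMeasure E n := by
  have hux : Measurable fun y => ‖u (x - y)‖ₑ := hu.enorm.comp (measurable_const_sub x)
  have hone : ‖mollify n u x‖ₑ ≤ ∫⁻ y, ‖u (x - y)‖ₑ ∂mollifierMeasure E n := by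
    rw [mollifierMeasure, lintegral_withDensity_eq_lintegral_mul _
      (measurable_mollifier n).ennreal_ofReal hux, mollify_apply]
    refine (enorm_integral_le_lintegral_enorm _).trans_eq (lintegral_congr fun y => ?_)
    rw [enorm_smul, Pi.mul_apply, Real.enorm_of_nonneg (mollifier_nonneg n y)]
  exact (ENNReal.rpow_le_rpow hone (zero_le_one.trans hp)).trans
    (rpow_lintegral_le_lintegral_rpow hux.aemeasurable hp)

theorem setLIntegral_comp_sub_right_le {f : E → ℝ≥0∞} {s t : Set E} (hs : MeasurableSet s)
    (ht : MeasurableSet t) {y : E} (hst : ∀ x ∈ s, x - y ∈ t) :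
    ∫⁻ x in s, f (x - y) ≤ ∫⁻ x in t, f x := by
  rw [← lintegral_indicator hs, ← lintegral_indicator ht,
    ← lintegral_sub_right_eq_self (t.indicator f) y]
  refine lintegral_mono fun x => Set.indicator_apply_le' (fun hx => ?_) fun _ => zero_le
  rw [Set.indicator_of_mem (hst x hx)]

theorem setLIntegral_mollify_rpow_le (n : ℕ) {u : E → F} (hu : StronglyMeasurable u)
    {p : ℝ} (hp : 1 ≤ p) {s t : Set E} (hs : MeasurableSet s) (ht : MeasurableSet t)
    (hst : ∀ x ∈ s, ∀ y : E, ‖y‖ ≤ 2 → x - y ∈ t) :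
    ∫⁻ x in s, ‖mollify n u x‖ₑ ^ p ≤ ∫⁻ x in t, ‖u x‖ₑ ^ p := by
  have hu2 : Measurable fun q : E × E => ‖u (q.1 - q.2)‖ₑ ^ p :=
    (hu.enorm.comp measurable_sub).pow_const p
  calc ∫⁻ x in s, ‖mollify n u x‖ₑ ^ p
      ≤ ∫⁻ x in s, ∫⁻ y, ‖u (x - y)‖ₑ ^ p ∂mollifierMeasure E n :=
        lintegral_mono fun x => enorm_mollify_rpow_le n hu x hp
    _ = ∫⁻ y, (∫⁻ x in s, ‖u (x - y)‖ₑ ^ p) ∂mollifierMeasure E n :=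
        lintegral_lintegral_swap hu2.aemeasurable
    _ ≤ ∫⁻ _, (∫⁻ x in t, ‖u x‖ₑ ^ p) ∂mollifierMeasure E n := by
        refine lintegral_mono_ae ((ae_norm_le_two_mollifierMeasure n).mono fun y hy => ?_)
        exact setLIntegral_comp_sub_right_le (f := fun x => ‖u x‖ₑ ^ p) hs ht
          fun x hx => hst x hx y hy
    _ = ∫⁻ x in t, ‖u x‖ₑ ^ p := by rw [lintegral_const, measure_univ, mul_one]

theorem eLpNorm_mollify_restrict_le (n : ℕ) {u : E → F} (hu : AEStronglyMeasurable u) {p : ℝ≥0∞}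
    (hp : 1 ≤ p) (hp' : p ≠ ⊤) {s t : Set E} (hs : MeasurableSet s) (ht : MeasurableSet t)
    (hst : ∀ x ∈ s, ∀ y : E, ‖y‖ ≤ 2 → x - y ∈ t) :
    eLpNorm (mollify n u) p (volume.restrict s) ≤ eLpNorm u p (volume.restrict t) := by
  have hp0 : p ≠ 0 := (zero_lt_one.trans_le hp).ne'
  rw [mollify_congr_ae n hu.ae_eq_mk, eLpNorm_congr_ae (ae_restrict_of_ae hu.ae_eq_mk),
    eLpNorm_eq_lintegral_rpow_enorm_toReal hp0 hp', eLpNorm_eq_lintegral_rpow_enorm_toReal hp0 hp']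
  refine ENNReal.rpow_le_rpow (setLIntegral_mollify_rpow_le n hu.stronglyMeasurable_mk ?_ hs ht hst)
    (by positivity)
  exact (ENNReal.ofReal_le_iff_le_toReal hp').1 (by simpa using hp)

theorem eLpNorm_mollify_le (n : ℕ) {u : E → F} (hu : AEStronglyMeasurable u) {p : ℝ≥0∞}
    (hp : 1 ≤ p) (hp' : p ≠ ⊤) : eLpNorm (mollify n u) p ≤ eLpNorm u p := by
  simpa using eLpNorm_mollify_restrict_le n hu hp hp' MeasurableSet.univ MeasurableSet.univ
    fun _ _ _ _ => Set.mem_univ _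

end Mollify

section LpConvergence

variable {α F : Type*} [MeasurableSpace α] {μ : Measure α} [NormedAddCommGroup F]

theorem eLpNorm_two_sq (f : α → F) : eLpNorm f 2 μ ^ 2 = ∫⁻ x, ‖f x‖ₑ ^ 2 ∂μ := by
  simpa using eLpNorm_nnreal_pow_eq_lintegral (f := f) (μ := μ) (p := 2) two_ne_zero

theorem tendsto_eLpNorm_restrict_of_antitone {f : α → F} {p : ℝ≥0∞} (hp : p ≠ ⊤) (hf : MemLp f p μ)
    {s : ℕ → Set α} (hs : ∀ n, MeasurableSet (s n)) (hanti : Antitone s) (hempty : ⋂ n, s n = ∅) :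
    Tendsto (fun n => eLpNorm f p (μ.restrict (s n))) atTop (𝓝 0) := by
  rcases eq_or_ne p 0 with rfl | hp0
  · simp
  have hfin := lintegral_rpow_enorm_lt_top_of_eLpNorm_lt_top hp0 hp hf.2
  set ν : Measure α := μ.withDensity fun x => ‖f x‖ₑ ^ p.toReal
  have : IsFiniteMeasure ν := isFiniteMeasure_withDensity hfin.ne
  have hlim : Tendsto (ν ∘ s) atTop (𝓝 0) := by
    simpa [hempty] using
      tendsto_measure_iInter_atTop (fun n => (hs n).nullMeasurableSet) hanti ⟨0, measure_ne_top ν _⟩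
  simpa [eLpNorm_eq_lintegral_rpow_enorm_toReal hp0 hp, ν, hs, Function.comp_def,
    ENNReal.toReal_pos hp0 hp] using hlim.ennrpow_const (1 / p.toReal)

theorem tendsto_eLpNorm_restrict_le_norm {E F : Type*} [NormedAddCommGroup E] [MeasurableSpace E]
    [OpensMeasurableSpace E] {μ : Measure E} [NormedAddCommGroup F] {u : E → F} {p : ℝ≥0∞}
    (hp : p ≠ ⊤) (hu : MemLp u p μ) (c : ℝ) :
    Tendsto (fun n : ℕ => eLpNorm u p (μ.restrict {x | (n : ℝ) - c ≤ ‖x‖})) atTop (𝓝 0) := by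
  refine tendsto_eLpNorm_restrict_of_antitone hp hu
    (fun n => (isClosed_le continuous_const continuous_norm).measurableSet)
    (fun m n hmn x hx => ?_) (Set.eq_empty_of_forall_notMem fun x hx => ?_)
  · exact (sub_le_sub_right (Nat.cast_le (α := ℝ).2 hmn) c).trans (hx : (n : ℝ) - c ≤ ‖x‖)
  · obtain ⟨n, hn⟩ := exists_nat_gt (‖x‖ + c)
    exact (lt_sub_iff_add_lt.2 hn).not_ge (Set.mem_iInter.1 hx n)

variable [InnerProductSpace ℝ F]

theorem eLpNorm_two_sub_sq_add_eLpNorm_two_add_sq {f g : α → F} (hf : AEStronglyMeasurable f μ)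
    (hg : AEStronglyMeasurable g μ) :
    eLpNorm (f - g) 2 μ ^ 2 + eLpNorm (f + g) 2 μ ^ 2 =
      2 * (eLpNorm f 2 μ ^ 2 + eLpNorm g 2 μ ^ 2) := by
  simp only [eLpNorm_two_sq]
  rw [add_comm, ← lintegral_add_left' ((hf.add hg).enorm.pow_const 2),
    ← lintegral_add_left' (hf.enorm.pow_const 2), ← lintegral_const_mul' _ _ ENNReal.ofNat_ne_top]
  exact lintegral_congr fun x => enorm_add_sq_add_enorm_sub_sq _ _

theorem tendsto_eLpNorm_two_sub_of_eLpNorm_le {v : ℕ → α → F} {g : α → F}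
    (hv : ∀ n, AEStronglyMeasurable (v n) μ) (hg : MemLp g 2 μ)
    (hle : ∀ n, eLpNorm (v n) 2 μ ≤ eLpNorm g 2 μ)
    (h : ∀ᵐ x ∂μ, Tendsto (fun n => v n x) atTop (𝓝 (g x))) :
    Tendsto (fun n => eLpNorm (v n - g) 2 μ) atTop (𝓝 0) := by
  have htwo : eLpNorm (g + g) 2 μ ^ 2 = 4 * eLpNorm g 2 μ ^ 2 := by
    rw [← two_smul ℝ g, eLpNorm_const_smul, mul_pow, Real.enorm_eq_ofReal zero_le_two,
      ENNReal.ofReal_ofNat]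
    norm_num
  have hsq : Tendsto (fun n => eLpNorm (v n - g) 2 μ ^ 2) atTop (𝓝 0) := by
    refine tendsto_zero_of_add_le_of_le_liminf (s := fun n => eLpNorm (v n + g) 2 μ ^ 2)
      (K := 4 * eLpNorm g 2 μ ^ 2) (by finiteness [hg.2]) (fun n => ?_) ?_
    · calc eLpNorm (v n - g) 2 μ ^ 2 + eLpNorm (v n + g) 2 μ ^ 2
          = 2 * (eLpNorm (v n) 2 μ ^ 2 + eLpNorm g 2 μ ^ 2) :=
            eLpNorm_two_sub_sq_add_eLpNorm_two_add_sq (hv n) hg.1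
        _ ≤ 2 * (eLpNorm g 2 μ ^ 2 + eLpNorm g 2 μ ^ 2) := by gcongr; exact hle n
        _ = 4 * eLpNorm g 2 μ ^ 2 := by ring
    · have hfatou : eLpNorm (g + g) 2 μ ≤ liminf (fun n => eLpNorm (v n + g) 2 μ) atTop :=
        Lp.eLpNorm_lim_le_liminf_eLpNorm (fun n => (hv n).add hg.1) _
          (h.mono fun x hx => hx.add_const _)
      rw [← htwo]
      exact (pow_le_pow_left' hfatou 2).trans_eq
        ((pow_left_mono 2).map_liminf_of_continuousAt _ (ENNReal.continuous_pow 2).continuousAt)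
  simpa [← ENNReal.rpow_natCast_mul] using hsq.ennrpow_const 2⁻¹

end LpConvergence

section Cutoff

variable {E F : Type*} [NormedAddCommGroup E] [InnerProductSpace ℝ E]

/-- A smooth radial function with values in `[0, 1]`, equal to `1` on the ball of radius `n + 1`
and supported in the ball of radius `2 * (n + 1)`. -/
noncomputable def cutoff (n : ℕ) (x : E) : ℝ := plateau (((n : ℝ) + 1)⁻¹ • x)

theorem contDiff_cutoff (n : ℕ) : ContDiff ℝ ∞ (cutoff (E := E) n) := contDiff_plateau_smul _

theorem hasCompactSupport_cutoff [ProperSpace E] (n : ℕ) : HasCompactSupport (cutoff (E := E) n) :=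
  hasCompactSupport_plateau.comp_smul (inv_ne_zero (Nat.cast_add_one_ne_zero n))

theorem norm_cutoff_le_one (n : ℕ) (x : E) : ‖cutoff n x‖ ≤ 1 :=
  (Real.norm_of_nonneg (plateau_nonneg _)).trans_le (plateau_le_one _)

theorem cutoff_congr (n : ℕ) {x y : E} (h : ‖x‖ = ‖y‖) : cutoff n x = cutoff n y :=
  plateau_smul_congr _ h

theorem cutoff_eq_one {n : ℕ} {x : E} (hx : ‖x‖ ≤ n + 1) : cutoff n x = 1 := by
  refine plateau_eq_one ?_
  rwa [norm_smul, norm_inv, Real.norm_of_nonneg (by positivity), inv_mul_le_one₀ (by positivity)]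

theorem eventually_cutoff_eq_one (x : E) : ∀ᶠ n : ℕ in atTop, cutoff n x = 1 := by
  filter_upwards [eventually_ge_atTop ⌈‖x‖⌉₊] with n hn
  exact cutoff_eq_one ((Nat.ceil_le.1 hn).trans (by simp))

theorem norm_gradient [CompleteSpace E] (f : E → ℝ) (x : E) : ‖gradient f x‖ = ‖fderiv ℝ f x‖ :=
  LinearIsometryEquiv.norm_map _ _

theorem gradient_cutoff_eq_zero [CompleteSpace E] {n : ℕ} {x : E} (hx : ‖x‖ < n + 1) :
    gradient (cutoff n) x = 0 := by
  have hone : cutoff n =ᶠ[𝓝 x] fun _ => (1 : ℝ) := by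
    filter_upwards [(isOpen_lt continuous_norm continuous_const).mem_nhds hx] with y hy
    exact cutoff_eq_one hy.le
  rw [hone.gradient_eq, gradient_fun_const]

theorem continuous_gradient [CompleteSpace E] {k : WithTop ℕ∞} {f : E → ℝ} (hf : ContDiff ℝ k f)
    (hk : k ≠ 0) : Continuous (gradient f) :=
  (LinearIsometryEquiv.continuous _).comp (hf.continuous_fderiv hk)

theorem hasCompactSupport_gradient [CompleteSpace E] {f : E → ℝ} (hf : HasCompactSupport f) :
    HasCompactSupport (gradient f) :=
  (hf.fderiv (𝕜 := ℝ)).comp_left (map_zero _)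

variable [FiniteDimensional ℝ E] [MeasurableSpace E] [BorelSpace E]
  [NormedAddCommGroup F] [NormedSpace ℝ F]

theorem eLpNorm_finrank_smul_comp_smul {r : ℝ} (hr : r ≠ 0) (f : E → F) :
    eLpNorm (fun x => r • f (r • x)) (Module.finrank ℝ E) volume =
      eLpNorm f (Module.finrank ℝ E) volume := by
  rcases eq_or_ne (Module.finrank ℝ E) 0 with hd | hd
  · simp [hd]
  have hemb : MeasurableEmbedding (r • · : E → E) :=
    (Homeomorph.smulOfNeZero r hr).measurableEmbedding
  have hscale : ENNReal.ofReal |(r ^ Module.finrank ℝ E)⁻¹| ^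
      (1 / (Module.finrank ℝ E : ℝ≥0∞)).toReal = ‖r‖ₑ⁻¹ := by
    rw [← Real.enorm_eq_ofReal_abs, enorm_inv (pow_ne_zero _ hr), enorm_pow, ENNReal.inv_pow,
      ← ENNReal.rpow_natCast, ← ENNReal.rpow_mul]
    simp [hd]
  calc eLpNorm (fun x => r • f (r • x)) (Module.finrank ℝ E) volume
      = ‖r‖ₑ * eLpNorm f (Module.finrank ℝ E) (Measure.map (r • ·) volume) := by
        rw [hemb.eLpNorm_map_measure]
        exact eLpNorm_const_smul _ _ _ _
    _ = ‖r‖ₑ * (‖r‖ₑ⁻¹ * eLpNorm f (Module.finrank ℝ E) volume) := by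
        rw [Measure.map_addHaar_smul _ hr,
          eLpNorm_smul_measure_of_ne_top (ENNReal.natCast_ne_top _), ← hscale, smul_eq_mul]
    _ = eLpNorm f (Module.finrank ℝ E) volume := by
        rw [← mul_assoc, ENNReal.mul_inv_cancel (by simpa using hr) enorm_ne_top, one_mul]

/-- The uniform bound on the gradients comes from the scale invariance of their `L^d` norm, where
`d` is the dimension. -/
theorem eLpNorm_gradient_cutoff (n : ℕ) :
    eLpNorm (gradient (cutoff (E := E) n)) (Module.finrank ℝ E) volume =
      eLpNorm (gradient (plateau (E := E))) (Module.finrank ℝ E) volume := by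
  rw [← eLpNorm_finrank_smul_comp_smul (inv_ne_zero (Nat.cast_add_one_ne_zero n))
    (gradient plateau)]
  refine congrArg (eLpNorm · _ _) (funext fun x => ?_)
  have hfderiv : fderiv ℝ (cutoff n) x = ((n : ℝ) + 1)⁻¹ • fderiv ℝ plateau (((n : ℝ) + 1)⁻¹ • x) :=
    fderiv_comp_smul _
  simp [gradient, hfderiv]

/-- The approximation of `u` by smooth functions with compact support: mollify, then cut off. -/
noncomputable def cutoffMollify (n : ℕ) (u : E → F) (x : E) : F := cutoff n x • mollify n u x

theorem contDiff_cutoffMollify (n : ℕ) {u : E → F} (hu : LocallyIntegrable u) :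
    ContDiff ℝ ∞ (cutoffMollify n u) :=
  (contDiff_cutoff n).smul (contDiff_mollify n hu)

theorem hasCompactSupport_cutoffMollify (n : ℕ) (u : E → F) :
    HasCompactSupport (cutoffMollify n u) :=
  (hasCompactSupport_cutoff n).smul_right

theorem norm_cutoffMollify_le (n : ℕ) (u : E → F) (x : E) :
    ‖cutoffMollify n u x‖ ≤ ‖mollify n u x‖ := by
  rw [cutoffMollify, norm_smul]
  exact mul_le_of_le_one_left (norm_nonneg _) (norm_cutoff_le_one n x)

theorem ae_tendsto_cutoffMollify [CompleteSpace F] {u : E → F} (hu : LocallyIntegrable u) :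
    ∀ᵐ x, Tendsto (fun n => cutoffMollify n u x) atTop (𝓝 (u x)) := by
  filter_upwards [ae_tendsto_mollify hu] with x hx
  refine hx.congr' ?_
  filter_upwards [eventually_cutoff_eq_one x] with n hn
  rw [cutoffMollify, hn, one_smul]

theorem tendsto_eLpNorm_two_cutoffMollify_sub {F : Type*} [NormedAddCommGroup F]
    [InnerProductSpace ℝ F] [CompleteSpace F] {g : E → F} (hg : MemLp g 2) :
    Tendsto (fun n => eLpNorm (cutoffMollify n g - g) 2 volume) atTop (𝓝 0) := by
  have hloc : LocallyIntegrable g := hg.locallyIntegrable one_le_two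
  refine tendsto_eLpNorm_two_sub_of_eLpNorm_le
    (fun n => (contDiff_cutoffMollify n hloc).continuous.aestronglyMeasurable) hg (fun n => ?_)
    (ae_tendsto_cutoffMollify hloc)
  exact (eLpNorm_mono (norm_cutoffMollify_le n g)).trans
    (eLpNorm_mollify_le n hg.1 one_le_two ENNReal.ofNat_ne_top)

theorem tendsto_eLpNorm_mollify_smul_gradient_cutoff {p r : ℝ≥0∞} (hp : 1 ≤ p) (hp' : p ≠ ⊤)
    [p.HolderTriple (Module.finrank ℝ E) r] {u : E → ℝ} (hu : MemLp u p) :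
    Tendsto (fun n => eLpNorm (mollify n u • gradient (cutoff (E := E) n)) r volume)
      atTop (𝓝 0) := by
  set T : ℕ → Set E := fun n => {x | (n : ℝ) - 1 ≤ ‖x‖}
  have hT (n : ℕ) : MeasurableSet (T n) :=
    (isClosed_le continuous_const continuous_norm).measurableSet
  have htail : Tendsto (fun n => eLpNorm u p (volume.restrict (T n))) atTop (𝓝 0) :=
    tendsto_eLpNorm_restrict_le_norm hp' hu 1
  have hfin : eLpNorm (gradient (plateau (E := E))) (Module.finrank ℝ E) volume ≠ ⊤ := by
    have hc := continuous_gradient (contDiff_plateau (E := E)) (by simp)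
    have hsupp := hasCompactSupport_gradient (hasCompactSupport_plateau (E := E))
    exact (hc.memLp_of_hasCompactSupport hsupp).2.ne
  refine tendsto_of_tendsto_of_tendsto_of_le_of_le tendsto_const_nhds
    (by simpa using ENNReal.Tendsto.mul_const htail (Or.inr hfin)) (fun _ => zero_le) fun n => ?_
  set s : Set E := {x | (n : ℝ) + 1 ≤ ‖x‖}
  have hs : MeasurableSet s := (isClosed_le continuous_const continuous_norm).measurableSet
  have hsupp : Function.support (mollify n u • gradient (cutoff n)) ⊆ s :=
    Function.support_subset_iff'.2 fun x hx => by
      rw [Pi.smul_apply', gradient_cutoff_eq_zero (not_le.1 hx), smul_zero]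
  have hmollify := (contDiff_mollify n (hu.locallyIntegrable hp)).continuous
  calc eLpNorm (mollify n u • gradient (cutoff n)) r volume
      = eLpNorm (mollify n u • gradient (cutoff n)) r (volume.restrict s) :=
        (eLpNorm_restrict_eq_of_support_subset hsupp).symm
    _ ≤ eLpNorm (mollify n u) p (volume.restrict s) *
          eLpNorm (gradient (cutoff n)) (Module.finrank ℝ E) (volume.restrict s) :=
        eLpNorm_smul_le_mul_eLpNorm
          (continuous_gradient (contDiff_cutoff n) (by simp)).aestronglyMeasurable
          hmollify.aestronglyMeasurable
    _ ≤ eLpNorm u p (volume.restrict (T n)) *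
          eLpNorm (gradient (plateau (E := E))) (Module.finrank ℝ E) volume := by
        refine mul_le_mul' (eLpNorm_mollify_restrict_le n hu.1 hp hp' hs (hT n) ?_) ?_
        · intro x (hx : (n : ℝ) + 1 ≤ ‖x‖) y hy
          have := norm_sub_norm_le x y
          change (n : ℝ) - 1 ≤ ‖x - y‖
          linarith
        · rw [← eLpNorm_gradient_cutoff n]
          exact eLpNorm_restrict_le _ _ _ _

theorem mollify_congr_norm (n : ℕ) {u : E → F} (hu : ∀ x y, ‖x‖ = ‖y‖ → u x = u y) {x y : E}
    (hxy : ‖x‖ = ‖y‖) : mollify n u x = mollify n u y := by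
  set e : E ≃ₗᵢ[ℝ] E := (ℝ ∙ (x - y))ᗮ.reflection
  have hex : e x = y := Submodule.reflection_sub hxy
  have hue : u ∘ e = u := funext fun z => hu _ _ (e.norm_map z)
  rw [← hex, ← Function.comp_apply (f := mollify n u), ← mollify_comp_linearIsometryEquiv, hue]

end Cutoff

section WeakGradient

variable {N : ℕ} {u v : Space N → ℝ} {g k : Space N → Space N}

theorem isWeakGradient_iff (hu : LocallyIntegrable u) (hg : LocallyIntegrable g) :
    IsWeakGradient u g ↔ ∀ φ : Space N → ℝ, IsTestFunction φ → ∀ w : Space N,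
      ∫ x, fderiv ℝ φ x w * u x = -inner ℝ (∫ x, φ x • g x) w := by
  have hinner (φ : Space N → ℝ) (hφ : IsTestFunction φ) (w : Space N) :
      ∫ x, inner ℝ (g x) w * φ x = inner ℝ (∫ x, φ x • g x) w := by
    rw [real_inner_comm, ← integral_inner
      (hg.integrable_smul_left_of_hasCompactSupport hφ.1.continuous hφ.2)]
    exact integral_congr_ae (Eventually.of_forall fun x => by
      simp only [inner_smul_right, real_inner_comm, mul_comm])
  refine ⟨fun h φ hφ w => ?_, fun h => ⟨hu, hg, fun φ hφ w => ?_⟩⟩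
  · simpa only [← hinner φ hφ w, mul_comm (u _)] using h.integral_eq φ hφ w
  · simpa only [hinner φ hφ w, mul_comm (u _)] using h φ hφ w

theorem IsWeakGradient.integral_fderiv_mul (h : IsWeakGradient u g) {φ : Space N → ℝ}
    (hφ : IsTestFunction φ) (w : Space N) :
    ∫ x, fderiv ℝ φ x w * u x = -inner ℝ (∫ x, φ x • g x) w :=
  (isWeakGradient_iff h.locallyIntegrable h.locallyIntegrable_grad).1 h φ hφ w

theorem IsTestFunction.integrable_fderiv_mul {φ : Space N → ℝ} (hφ : IsTestFunction φ)
    (hu : LocallyIntegrable u) (w : Space N) : Integrable fun x => fderiv ℝ φ x w * u x :=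
  hu.integrable_smul_left_of_hasCompactSupport
    ((hφ.1.continuous_fderiv (by simp)).clm_apply continuous_const) (hφ.2.fderiv_apply (𝕜 := ℝ) w)

theorem isWeakGradient_gradient (hu : ContDiff ℝ 1 u) : IsWeakGradient u (gradient u) := by
  refine ⟨hu.continuous.locallyIntegrable,
    (continuous_gradient hu one_ne_zero).locallyIntegrable, fun φ hφ w => ?_⟩
  simp only [inner_gradient_left]
  have hfderiv : Continuous fun x => fderiv ℝ u x w :=
    (hu.continuous_fderiv one_ne_zero).clm_apply continuous_const
  refine integral_mul_fderiv_eq_neg_fderiv_mul_of_integrable ?_ ?_ ?_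
    (fun x _ => hu.differentiable one_ne_zero x) (fun x _ => hφ.1.differentiable (by simp) x)
  · exact (hfderiv.mul hφ.1.continuous).integrable_of_hasCompactSupport hφ.2.mul_left
  · simpa only [mul_comm] using hφ.integrable_fderiv_mul hu.continuous.locallyIntegrable w
  · exact (hu.continuous.mul hφ.1.continuous).integrable_of_hasCompactSupport hφ.2.mul_left

theorem IsWeakGradient.congr (h : IsWeakGradient u g) (huv : u =ᵐ[volume] v)
    (hgk : g =ᵐ[volume] k) : IsWeakGradient v k := by
  refine ⟨h.locallyIntegrable.congr huv, h.locallyIntegrable_grad.congr hgk, fun φ hφ w => ?_⟩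
  rw [← integral_congr_ae (huv.mono fun x hx => congrArg (· * fderiv ℝ φ x w) hx),
    ← integral_congr_ae (hgk.mono fun x hx => congrArg (inner ℝ · w * φ x) hx),
    h.integral_eq φ hφ w]

theorem IsWeakGradient.add (hu : IsWeakGradient u g) (hv : IsWeakGradient v k) :
    IsWeakGradient (u + v) (g + k) := by
  have hug := hu.locallyIntegrable_grad
  have hvk := hv.locallyIntegrable_grad
  refine (isWeakGradient_iff (hu.locallyIntegrable.add hv.locallyIntegrable) (hug.add hvk)).2
    fun φ hφ w => ?_
  simp only [Pi.add_apply, mul_add, smul_add]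
  rw [integral_add (hφ.integrable_fderiv_mul hu.locallyIntegrable w)
      (hφ.integrable_fderiv_mul hv.locallyIntegrable w),
    integral_add (hug.integrable_smul_left_of_hasCompactSupport hφ.1.continuous hφ.2)
      (hvk.integrable_smul_left_of_hasCompactSupport hφ.1.continuous hφ.2),
    hu.integral_fderiv_mul hφ, hv.integral_fderiv_mul hφ, inner_add_left, neg_add]

theorem IsWeakGradient.const_smul (hu : IsWeakGradient u g) (c : ℝ) :
    IsWeakGradient (c • u) (c • g) := by
  refine ⟨hu.locallyIntegrable.smul c, hu.locallyIntegrable_grad.smul c, fun φ hφ w => ?_⟩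
  simp only [Pi.smul_apply, smul_eq_mul, inner_smul_left, conj_trivial, mul_assoc]
  rw [integral_const_mul, integral_const_mul, hu.integral_eq φ hφ w, mul_neg]

theorem tendsto_integral_smul_of_tendsto_eLpNorm {α F : Type*} [MeasurableSpace α] {μ : Measure α}
    [NormedAddCommGroup F] [NormedSpace ℝ F] {p q : ℝ≥0∞} [p.HolderConjugate q]
    {φ : α → ℝ} (hφ : MemLp φ p μ) {f : ℕ → α → F} {f₀ : α → F} (hf : ∀ n, MemLp (f n) q μ)
    (hf₀ : MemLp f₀ q μ) (h : Tendsto (fun n => eLpNorm (f n - f₀) q μ) atTop (𝓝 0)) :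
    Tendsto (fun n => ∫ x, φ x • f n x ∂μ) atTop (𝓝 (∫ x, φ x • f₀ x ∂μ)) := by
  refine tendsto_integral_of_L1' _ (hφ.1.smul hf₀.1)
    (Eventually.of_forall fun n => memLp_one_iff_integrable.1 ((hf n).smul hφ)) ?_
  refine tendsto_of_tendsto_of_tendsto_of_le_of_le tendsto_const_nhds
    (by simpa using ENNReal.Tendsto.const_mul h (Or.inr hφ.2.ne)) (fun _ => zero_le) fun n => ?_
  have hholder := eLpNorm_smul_le_mul_eLpNorm (p := p) (q := q) (r := 1) ((hf n).1.sub hf₀.1) hφ.1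
  rw [smul_sub] at hholder
  exact hholder

theorem IsWeakGradient.of_tendsto {p q : ℝ≥0∞} (hp : 1 ≤ p) (hq : 1 ≤ q)
    {f : ℕ → Space N → ℝ} {G : ℕ → Space N → Space N} (h : ∀ n, IsWeakGradient (f n) (G n))
    (hf : ∀ n, MemLp (f n) p) (hG : ∀ n, MemLp (G n) q) (hu : MemLp u p) (hg : MemLp g q)
    (hfu : Tendsto (fun n => eLpNorm (f n - u) p volume) atTop (𝓝 0))
    (hGg : Tendsto (fun n => eLpNorm (G n - g) q volume) atTop (𝓝 0)) : IsWeakGradient u g := by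
  refine (isWeakGradient_iff (hu.locallyIntegrable hp) (hg.locallyIntegrable hq)).2 fun φ hφ w => ?_
  have := (ENNReal.HolderConjugate.conjExponent hp).symm
  have := (ENNReal.HolderConjugate.conjExponent hq).symm
  have hfderiv : MemLp (fun x => fderiv ℝ φ x w) p.conjExponent :=
    Continuous.memLp_of_hasCompactSupport
      ((hφ.1.continuous_fderiv (by simp)).clm_apply continuous_const)
      (hφ.2.fderiv_apply (𝕜 := ℝ) w)
  have hφq : MemLp φ q.conjExponent := hφ.1.continuous.memLp_of_hasCompactSupport hφ.2
  refine tendsto_nhds_unique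
    (tendsto_integral_smul_of_tendsto_eLpNorm hfderiv hf hu hfu)
    (((tendsto_integral_smul_of_tendsto_eLpNorm hφq hG hg hGg).inner
      tendsto_const_nhds).neg.congr fun n => ?_)
  exact ((h n).integral_fderiv_mul hφ w).symm

end WeakGradient

section Approximation

variable {N : ℕ} {u : Space N → ℝ} {g : Space N → Space N}

theorem isTestFunction_mollifier_sub (n : ℕ) (x : Space N) :
    IsTestFunction fun y => mollifier n (x - y) :=
  ⟨(contDiff_mollifier n).comp (contDiff_const.sub contDiff_id),
    (hasCompactSupport_mollifier n).comp_homeomorph (Homeomorph.subLeft x)⟩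

theorem fderiv_mollify_apply (n : ℕ) (hu : LocallyIntegrable u) (x w : Space N) :
    fderiv ℝ (mollify n u) x w = ∫ y, fderiv ℝ (mollifier n) (x - y) w * u y := by
  have hmoll := contDiff_mollifier (E := Space N) n
  have hfderiv := (hasCompactSupport_mollifier (E := Space N) n).hasFDerivAt_convolution_right
    (ContinuousLinearMap.lsmul ℝ ℝ).flip hu (hmoll.of_le (by simp)) x
  rw [convolution_flip] at hfderiv
  rw [mollify, hfderiv.fderiv, convolution_precompR_apply _ hu
    ((hasCompactSupport_mollifier n).fderiv (𝕜 := ℝ)) (hmoll.continuous_fderiv (by simp))]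
  rfl

theorem IsWeakGradient.gradient_mollify (h : IsWeakGradient u g) (n : ℕ) :
    gradient (mollify n u) = mollify n g := by
  funext x
  refine ext_inner_right ℝ fun w => ?_
  have hreflect (y : Space N) :
      fderiv ℝ (fun y => mollifier n (x - y)) y w = -fderiv ℝ (mollifier n) (x - y) w := by
    have hdiff := (contDiff_mollifier (E := Space N) n).differentiable (by simp) (x - y)
    have hcomp := hdiff.hasFDerivAt.comp y ((hasFDerivAt_id y).const_sub x)
    simpa [Function.comp_def] using DFunLike.congr_fun hcomp.fderiv w
  have hw := h.integral_fderiv_mul (isTestFunction_mollifier_sub n x) w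
  simp only [hreflect, neg_mul, integral_neg, neg_inj] at hw
  rw [inner_gradient_left, fderiv_mollify_apply n h.locallyIntegrable, hw, mollify_apply_swap]

theorem IsWeakGradient.gradient_cutoffMollify (h : IsWeakGradient u g) (n : ℕ) :
    gradient (cutoffMollify n u) =
      cutoffMollify n g + mollify n u • gradient (cutoff n) := by
  funext x
  refine ext_inner_right ℝ fun w => ?_
  have hcut := (contDiff_cutoff (E := Space N) n).differentiable (by simp) x
  have hmoll := (contDiff_mollify n h.locallyIntegrable).differentiable (by simp) x
  have hprod : fderiv ℝ (cutoffMollify n u) x =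
      cutoff n x • fderiv ℝ (mollify n u) x + mollify n u x • fderiv ℝ (cutoff n) x :=
    fderiv_mul hcut hmoll
  rw [inner_gradient_left, hprod]
  simp [inner_add_left, inner_smul_left, inner_gradient_left, cutoffMollify, ← h.gradient_mollify]

theorem isTestFunction_cutoffMollify (n : ℕ) (hu : LocallyIntegrable u) :
    IsTestFunction (cutoffMollify n u) :=
  ⟨contDiff_cutoffMollify n hu, hasCompactSupport_cutoffMollify n u⟩

theorem IsWeakGradient.tendsto_eLpNorm_gradient_cutoffMollify_sub {p : ℝ≥0∞} (hp : 1 ≤ p)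
    (hp' : p ≠ ⊤) [p.HolderTriple N 2] (h : IsWeakGradient u g) (hu : MemLp u p)
    (hg : MemLp g 2) :
    Tendsto (fun n => eLpNorm (gradient (cutoffMollify n u) - g) 2 volume) atTop (𝓝 0) := by
  have : p.HolderTriple (Module.finrank ℝ (Space N)) 2 := by
    rw [finrank_euclideanSpace_fin]; infer_instance
  have hsum := (tendsto_eLpNorm_two_cutoffMollify_sub hg).add
    (tendsto_eLpNorm_mollify_smul_gradient_cutoff (r := 2) hp hp' hu)
  rw [add_zero] at hsum
  refine tendsto_of_tendsto_of_tendsto_of_le_of_le tendsto_const_nhds hsum (fun _ => zero_le)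
    fun n => ?_
  have hcut := (contDiff_cutoffMollify n h.locallyIntegrable_grad).continuous
  have hmoll := (contDiff_mollify n h.locallyIntegrable).continuous
  have hgrad := continuous_gradient (contDiff_cutoff (E := Space N) n) (by simp)
  rw [h.gradient_cutoffMollify, add_sub_right_comm]
  exact eLpNorm_add_le (hcut.aestronglyMeasurable.sub hg.1)
    (hmoll.smul hgrad).aestronglyMeasurable one_le_two

theorem coulombEnergy_cutoffMollify_le (hN : 3 ≤ N) (n : ℕ) (hu : StronglyMeasurable u)
    (hloc : LocallyIntegrable u) : coulombEnergy (cutoffMollify n u) ≤ coulombEnergy u :=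
  (coulombEnergy_mono (Eventually.of_forall (norm_cutoffMollify_le n u))).trans
    (coulombEnergy_le_of_average hN hu.measurable (contDiff_mollify n hloc).continuous.measurable
      fun x => by simpa using enorm_mollify_rpow_le n hu x one_le_two)

theorem tendsto_coulombEnergy_cutoffMollify_sub (hN : 3 ≤ N) (hu : StronglyMeasurable u)
    (hloc : LocallyIntegrable u) (hfin : coulombEnergy u ≠ ⊤) :
    Tendsto (fun n => coulombEnergy (cutoffMollify n u - u)) atTop (𝓝 0) :=
  tendsto_coulombEnergy_sub hN (fun n => (contDiff_cutoffMollify n hloc).continuous.measurable)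
    hu.measurable hfin (fun n => coulombEnergy_cutoffMollify_le hN n hu hloc)
    (ae_tendsto_cutoffMollify hloc)

theorem isRadial_iff : IsRadial u ↔ ∀ x y, ‖x‖ = ‖y‖ → u x = u y :=
  (exists_congr fun _ => funext_iff.symm).trans (Function.factorsThrough_iff (f := norm) u).symm

theorem IsRadial.cutoffMollify (n : ℕ) (hu : IsRadial u) : IsRadial (cutoffMollify n u) :=
  isRadial_iff.2 fun x y hxy => by
    rw [_root_.cutoffMollify, _root_.cutoffMollify, cutoff_congr n hxy,
      mollify_congr_norm n (isRadial_iff.1 hu) hxy]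

end Approximation

section Sobolev

variable {N : ℕ} {u : Space N → ℝ} {g : Space N → Space N}

/-- The critical Sobolev exponent `2N / (N - 2)` of the gradient in `L²`. -/
noncomputable def sobolevExponent (N : ℕ) : ℝ≥0∞ := ENNReal.ofReal (2 * (N : ℝ) / ((N : ℝ) - 2))

theorem sobolevExponent_ne_top : sobolevExponent N ≠ ⊤ := ENNReal.ofReal_ne_top

theorem one_le_sobolevExponent (hN : 3 ≤ N) : 1 ≤ sobolevExponent N := by
  have hN' : (3 : ℝ) ≤ N := mod_cast hN
  rw [sobolevExponent, ENNReal.one_le_ofReal, one_le_div (by linarith)]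
  linarith

theorem holderTriple_sobolevExponent (hN : 3 ≤ N) : (sobolevExponent N).HolderTriple N 2 where
  inv_add_inv_eq_inv := by
    have hN' : (3 : ℝ) ≤ N := mod_cast hN
    rw [sobolevExponent, ← ENNReal.ofReal_natCast, ← ENNReal.ofReal_ofNat,
      ← ENNReal.ofReal_inv_of_pos (div_pos (by linarith) (by linarith)),
      ← ENNReal.ofReal_inv_of_pos (by linarith), ← ENNReal.ofReal_inv_of_pos two_pos,
      ← ENNReal.ofReal_add (inv_nonneg.2 (div_nonneg (by linarith) (by linarith)))
        (inv_nonneg.2 (by linarith))]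
    congr 1
    field_simp
    ring

/-- The constant of the Sobolev inequality `‖u‖_{2N/(N-2)} ≤ S ‖∇u‖_2`. -/
noncomputable def sobolevConst (N : ℕ) : NNReal :=
  SNormLESNormFDerivOfEqConst ℝ (volume : Measure (Space N)) (2 : NNReal)

theorem IsTestFunction.eLpNorm_sobolevExponent_le (hN : 3 ≤ N) (hu : IsTestFunction u) :
    eLpNorm u (sobolevExponent N) ≤ sobolevConst N * eLpNorm (gradient u) 2 := by
  have hN' : (3 : ℝ) ≤ N := mod_cast hN
  have hN₂ : (N : ℝ) - 2 ≠ 0 := by linarith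
  rw [eLpNorm_congr_norm_ae (Eventually.of_forall (norm_gradient u))]
  refine eLpNorm_le_eLpNorm_fderiv_of_eq volume (hu.1.of_le (by simp)) hu.2 (p := 2)
    (p' := (2 * (N : ℝ) / ((N : ℝ) - 2)).toNNReal) (by norm_num)
    (by rw [finrank_euclideanSpace_fin]; omega) ?_
  rw [Real.coe_toNNReal _ (div_nonneg (by linarith) (by linarith)), finrank_euclideanSpace_fin,
    NNReal.coe_inv, NNReal.coe_ofNat]
  field_simp

theorem IsWeakGradient.eLpNorm_sobolevExponent_le (hN : 3 ≤ N) (h : IsWeakGradient u g)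
    (hu : MemLp u (sobolevExponent N)) (hg : MemLp g 2) :
    eLpNorm u (sobolevExponent N) ≤ sobolevConst N * eLpNorm g 2 := by
  have htest (n : ℕ) := isTestFunction_cutoffMollify n h.locallyIntegrable
  have hbound (n : ℕ) : eLpNorm (cutoffMollify n u) (sobolevExponent N) ≤
      sobolevConst N * (eLpNorm (gradient (cutoffMollify n u) - g) 2 volume + eLpNorm g 2) := by
    refine ((htest n).eLpNorm_sobolevExponent_le hN).trans (mul_le_mul_right ?_ _)
    have hmeas := (continuous_gradient (htest n).1 (by simp)).aestronglyMeasurable (μ := volume)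
    simpa only [sub_add_cancel] using eLpNorm_add_le (hmeas.sub hg.1) hg.1 one_le_two
  have : (sobolevExponent N).HolderTriple N 2 := holderTriple_sobolevExponent hN
  have hlim := ENNReal.Tendsto.const_mul (a := (sobolevConst N : ℝ≥0∞))
    ((h.tendsto_eLpNorm_gradient_cutoffMollify_sub (one_le_sobolevExponent hN)
      sobolevExponent_ne_top hu hg).add_const (eLpNorm g 2)) (Or.inr ENNReal.coe_ne_top)
  have hfatou : eLpNorm u (sobolevExponent N) ≤
      liminf (fun n => eLpNorm (cutoffMollify n u) (sobolevExponent N)) atTop :=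
    Lp.eLpNorm_lim_le_liminf_eLpNorm (fun n => (htest n).1.continuous.aestronglyMeasurable) u
      (ae_tendsto_cutoffMollify h.locallyIntegrable)
  refine (hfatou.trans (liminf_le_liminf (Eventually.of_forall hbound))).trans_eq ?_
  rw [hlim.liminf_eq, zero_add]

end Sobolev

section WeakGrad

variable {N : ℕ} {u f : Space N → ℝ} {g : Space N → Space N}

theorem isWeakGradient_weakGrad (h : ∃ g, IsWeakGradient u g) :
    IsWeakGradient u (weakGrad u) := by
  rw [weakGrad, dif_pos h]
  exact h.choose_spec

theorem IsWeakGradient.weakGrad_ae_eq (h : IsWeakGradient f g) (huf : u =ᵐ[volume] f) :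
    weakGrad u =ᵐ[volume] g :=
  have hu : IsWeakGradient u g := h.congr huf.symm .rfl
  (isWeakGradient_weakGrad ⟨g, hu⟩).ae_eq hu

theorem MemD12.memLp (h : MemD12 u) : MemLp u (sobolevExponent N) := h.1

theorem MemD12.isWeakGradient (h : MemD12 u) : IsWeakGradient u (weakGrad u) :=
  isWeakGradient_weakGrad (h.2.imp fun _ hg => hg.1)

theorem MemD12.memLp_weakGrad (h : MemD12 u) : MemLp (weakGrad u) 2 :=
  have ⟨_, hg, hg₂⟩ := h.2
  (memLp_congr_ae (hg.weakGrad_ae_eq .rfl)).2 hg₂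

theorem IsWeakGradient.memD12 (hg : IsWeakGradient f g) (huf : u =ᵐ[volume] f)
    (hf : MemLp f (sobolevExponent N)) (hg₂ : MemLp g 2) : MemD12 u :=
  ⟨(memLp_congr_ae huf).2 hf, g, hg.congr huf.symm .rfl, hg₂⟩

theorem gradEnergy_eq_eLpNorm_sq (u : Space N → ℝ) :
    gradEnergy u = eLpNorm (weakGrad u) 2 ^ 2 := by
  simp only [gradEnergy, eLpNorm_two_sq, ENNReal.ofReal_pow (norm_nonneg _), ofReal_norm]

end WeakGrad

section SpaceE

variable {N : ℕ} {u : Space N →ₘ[volume] ℝ} {φ : Space N → ℝ}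

theorem IsTestFunction.mem_spaceE (hN : 3 ≤ N) (hφ : IsTestFunction φ) (h : u =ᵐ[volume] φ) :
    u ∈ spaceE N := by
  have hφ₁ : ContDiff ℝ 1 φ := hφ.1.of_le (by simp)
  refine ⟨(isWeakGradient_gradient hφ₁).memD12 h
    (hφ₁.continuous.memLp_of_hasCompactSupport hφ.2)
    ((continuous_gradient hφ₁ one_ne_zero).memLp_of_hasCompactSupport
      (hasCompactSupport_gradient hφ.2)), ?_⟩
  rw [coulombEnergy_congr h]
  exact hφ.coulombEnergy_lt_top (by omega)

theorem testClasses_subset_spaceE (hN : 3 ≤ N) : testClasses N ⊆ spaceE N :=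
  fun _ ⟨_, hφ, h⟩ => hφ.mem_spaceE hN h

theorem radialTestClasses_subset_spaceEr (hN : 3 ≤ N) : radialTestClasses N ⊆ spaceEr N :=
  fun _ ⟨φ, hφ, hrad, h⟩ => ⟨hφ.mem_spaceE hN h, φ, hrad, h⟩

/-- `E(ℝ^N)` as a vector space. -/
def submoduleE (hN : 3 ≤ N) : Submodule ℝ (Space N →ₘ[volume] ℝ) where
  carrier := spaceE N
  add_mem' {u v} hu hv := by
    have h := AEEqFun.coeFn_add u v
    refine ⟨(hu.1.isWeakGradient.add hv.1.isWeakGradient).memD12 h (hu.1.memLp.add hv.1.memLp)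
      (hu.1.memLp_weakGrad.add hv.1.memLp_weakGrad), ?_⟩
    rw [coulombEnergy_congr h]
    exact (le_self_add.trans (coulombEnergy_add_add_sub_le hN u.measurable v.measurable)).trans_lt
      (ENNReal.mul_lt_top (by norm_num) (ENNReal.add_lt_top.2 ⟨hu.2, hv.2⟩))
  zero_mem' := IsTestFunction.mem_spaceE hN ⟨contDiff_const, .zero⟩ AEEqFun.coeFn_zero
  smul_mem' c u hu := by
    have h := AEEqFun.coeFn_smul c u
    refine ⟨(hu.1.isWeakGradient.const_smul c).memD12 h (hu.1.memLp.const_smul c)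
      (hu.1.memLp_weakGrad.const_smul c), ?_⟩
    rw [coulombEnergy_congr h, coulombEnergy_const_smul]
    exact ENNReal.mul_lt_top (by simp) hu.2

/-- The inclusion of `E(ℝ^N)` into `L^{2N/(N-2)}`. -/
noncomputable def toSobolevLp (hN : 3 ≤ N) :
    submoduleE hN →ₗ[ℝ] Lp ℝ (sobolevExponent N) (volume : Measure (Space N)) where
  toFun u := ⟨u, Lp.mem_Lp_iff_memLp.2 u.2.1.memLp⟩
  map_add' _ _ := rfl
  map_smul' _ _ := rfl

/-- The weak gradient as a linear map from `E(ℝ^N)` to `L²`. -/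
noncomputable def weakGradL2 (hN : 3 ≤ N) :
    submoduleE hN →ₗ[ℝ] Lp (Space N) 2 (volume : Measure (Space N)) where
  toFun u := u.2.1.memLp_weakGrad.toLp (weakGrad u)
  map_add' u v := by
    rw [← MemLp.toLp_add, MemLp.toLp_eq_toLp_iff]
    exact (u.2.1.isWeakGradient.add v.2.1.isWeakGradient).weakGrad_ae_eq (AEEqFun.coeFn_add _ _)
  map_smul' c u := by
    rw [RingHom.id_apply, ← MemLp.toLp_const_smul, MemLp.toLp_eq_toLp_iff]
    exact (u.2.1.isWeakGradient.const_smul c).weakGrad_ae_eq (AEEqFun.coeFn_smul _ _)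

/-- The Coulomb seminorm `D(u²,u²)^{1/4}` on `E(ℝ^N)`. -/
noncomputable def coulombSeminorm (hN : 3 ≤ N) : Seminorm ℝ (submoduleE hN) :=
  Seminorm.of (fun u => (coulombEnergy u.1 ^ (1 / 4 : ℝ)).toReal)
    (fun u v => by
      have hfin (w : submoduleE hN) : coulombEnergy w.1 ^ (1 / 4 : ℝ) ≠ ⊤ :=
        ENNReal.rpow_ne_top_of_nonneg (by norm_num) w.2.2.ne
      rw [← ENNReal.toReal_add (hfin u) (hfin v), Submodule.coe_add,
        coulombEnergy_congr (AEEqFun.coeFn_add _ _)]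
      exact ENNReal.toReal_mono (ENNReal.add_ne_top.2 ⟨hfin u, hfin v⟩)
        (coulombEnergy_add_rpow_le hN u.1.measurable v.1.measurable))
    (fun c u => by
      rw [Submodule.coe_smul, coulombEnergy_congr (AEEqFun.coeFn_smul _ _),
        coulombEnergy_const_smul, ENNReal.mul_rpow_of_nonneg _ _ (by norm_num), ENNReal.toReal_mul,
        ← ENNReal.rpow_natCast, ← ENNReal.rpow_mul]
      norm_num)

variable {hN : 3 ≤ N}

theorem coeFn_toSobolevLp (u : submoduleE hN) : (toSobolevLp hN u : Space N → ℝ) = u.1 :=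
  rfl

theorem coeFn_weakGradL2 (u : submoduleE hN) : weakGradL2 hN u =ᵐ[volume] weakGrad u.1 :=
  MemLp.coeFn_toLp u.2.1.memLp_weakGrad

theorem norm_weakGradL2 (u : submoduleE hN) :
    ‖weakGradL2 hN u‖ = (eLpNorm (weakGrad u.1) 2 volume).toReal :=
  Lp.norm_toLp _ u.2.1.memLp_weakGrad

theorem norm_toSobolevLp_le (u : submoduleE hN) :
    ‖toSobolevLp hN u‖ ≤ sobolevConst N * ‖weakGradL2 hN u‖ := by
  have h := u.2.1.isWeakGradient.eLpNorm_sobolevExponent_le hN u.2.1.memLp u.2.1.memLp_weakGrad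
  have hfin := ENNReal.mul_ne_top (a := (sobolevConst N : ℝ≥0∞)) ENNReal.coe_ne_top
    u.2.1.memLp_weakGrad.2.ne
  rw [norm_weakGradL2, ← ENNReal.coe_toReal, ← ENNReal.toReal_mul]
  exact ENNReal.toReal_mono hfin h

theorem coulombSeminorm_apply (u : submoduleE hN) :
    coulombSeminorm hN u = (coulombEnergy u.1 ^ (1 / 4 : ℝ)).toReal :=
  rfl

theorem coulombSeminorm_pow_four (u : submoduleE hN) :
    coulombSeminorm hN u ^ 4 = (coulombEnergy u.1).toReal := by
  rw [coulombSeminorm_apply, ← ENNReal.toReal_pow, ← ENNReal.rpow_natCast, ← ENNReal.rpow_mul]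
  norm_num

theorem coulombSeminorm_le_iff {u : submoduleE hN} {C : ℝ} (hC : 0 ≤ C) :
    coulombSeminorm hN u ≤ C ↔ coulombEnergy u.1 ≤ ENNReal.ofReal (C ^ 4) := by
  rw [ENNReal.le_ofReal_iff_toReal_le u.2.2.ne (by positivity), ← coulombSeminorm_pow_four,
    pow_le_pow_iff_left₀ (apply_nonneg _ _) hC (by norm_num)]

theorem coulombSeminorm_clarkson (u v : submoduleE hN) :
    coulombSeminorm hN (u + v) ^ 4 + coulombSeminorm hN (u - v) ^ 4 ≤
      8 * (coulombSeminorm hN u ^ 4 + coulombSeminorm hN v ^ 4) := by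
  have h := coulombEnergy_add_add_sub_le hN u.1.measurable v.1.measurable
  rw [← coulombEnergy_congr (AEEqFun.coeFn_add u.1 v.1), ← Submodule.coe_add,
    ← coulombEnergy_congr (AEEqFun.coeFn_sub u.1 v.1), ← AddSubgroupClass.coe_sub] at h
  have hreal := ENNReal.toReal_mono (ENNReal.mul_ne_top (by norm_num)
    (ENNReal.add_ne_top.2 ⟨u.2.2.ne, v.2.2.ne⟩)) h
  rw [ENNReal.toReal_add (u + v).2.2.ne (u - v).2.2.ne, ENNReal.toReal_mul,
    ENNReal.toReal_add u.2.2.ne v.2.2.ne] at hreal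
  simpa only [coulombSeminorm_pow_four, ENNReal.toReal_ofNat] using hreal

noncomputable instance : Norm (submoduleE hN) := ⟨fun u => normE u.1⟩

theorem norm_submoduleE_eq (u : submoduleE hN) :
    ‖u‖ = √(‖weakGradL2 hN u‖ ^ 2 + coulombSeminorm hN u ^ 2) := by
  have hgrad : ‖weakGradL2 hN u‖ ^ 2 = (gradEnergy u.1).toReal := by
    rw [gradEnergy_eq_eLpNorm_sq, ENNReal.toReal_pow, norm_weakGradL2]
  change normE u.1 = _
  rw [normE, hgrad, ← coulombSeminorm_pow_four, pow_mul _ 2 2, Real.sqrt_sq (sq_nonneg _)]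

theorem norm_submoduleE_sq (u : submoduleE hN) :
    ‖u‖ ^ 2 = ‖weakGradL2 hN u‖ ^ 2 + coulombSeminorm hN u ^ 2 := by
  rw [norm_submoduleE_eq, Real.sq_sqrt (by positivity)]

theorem norm_weakGradL2_le (u : submoduleE hN) : ‖weakGradL2 hN u‖ ≤ ‖u‖ := by
  rw [norm_submoduleE_eq]
  exact Real.le_sqrt_of_sq_le (le_add_of_nonneg_right (sq_nonneg _))

theorem coulombSeminorm_le_norm (u : submoduleE hN) : coulombSeminorm hN u ≤ ‖u‖ := by
  rw [norm_submoduleE_eq]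
  exact Real.le_sqrt_of_sq_le (le_add_of_nonneg_left (sq_nonneg _))

theorem eq_zero_of_weakGradL2_eq_zero {u : submoduleE hN} (h : weakGradL2 hN u = 0) : u = 0 := by
  have hle := norm_toSobolevLp_le u
  rw [h, norm_zero, mul_zero] at hle
  have hp : 0 < sobolevExponent N := zero_lt_one.trans_le (one_le_sobolevExponent hN)
  have hzero : toSobolevLp hN u = 0 :=
    (Lp.norm_eq_zero_iff hp).1 (hle.antisymm ENNReal.toReal_nonneg)
  exact Subtype.ext congr($hzero.1)

theorem core_submoduleE (hN : 3 ≤ N) : NormedSpace.Core ℝ (submoduleE hN) where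
  norm_nonneg _ := Real.sqrt_nonneg _
  norm_smul c u := by
    rw [norm_submoduleE_eq, norm_submoduleE_eq, map_smul, norm_smul, map_smul_eq_mul, mul_pow,
      mul_pow, ← mul_add, Real.sqrt_mul (sq_nonneg _), Real.sqrt_sq (norm_nonneg c)]
  norm_triangle u v := by
    simp only [norm_submoduleE_eq]
    refine sqrt_add_sq_le (norm_nonneg _) (apply_nonneg _ _) ?_ (map_add_le_add _ u v)
    rw [map_add]
    exact norm_add_le _ _
  norm_eq_zero_iff u := by
    refine ⟨fun h => eq_zero_of_weakGradL2_eq_zero (norm_le_zero_iff.1 ?_), fun h => ?_⟩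
    · exact (norm_weakGradL2_le u).trans h.le
    · rw [h, norm_submoduleE_eq]
      simp only [map_zero, norm_zero, zero_pow two_ne_zero, add_zero, Real.sqrt_zero]

noncomputable instance : NormedAddCommGroup (submoduleE hN) :=
  NormedAddCommGroup.ofCore (core_submoduleE hN)

end SpaceE

section Limits

variable {N : ℕ} {hN : 3 ≤ N}

theorem coulombEnergy_le_of_tendsto {p : ℝ≥0∞} [Fact (1 ≤ p)]
    {f : ℕ → Lp ℝ p (volume : Measure (Space N))} {g : Lp ℝ p (volume : Measure (Space N))}
    (h : Tendsto f atTop (𝓝 g)) {C : ℝ≥0∞} (hC : ∀ᶠ n in atTop, coulombEnergy (f n) ≤ C) :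
    coulombEnergy g ≤ C := by
  obtain ⟨k, hk, hae⟩ := (tendstoInMeasure_of_tendsto_Lp h).exists_seq_tendsto_ae
  calc coulombEnergy g
      ≤ liminf (fun n => coulombEnergy (f (k n))) atTop :=
        coulombEnergy_le_liminf (fun n => (Lp.stronglyMeasurable _).measurable) hae
    _ ≤ C := liminf_le_of_frequently_le' (hk.tendsto_atTop.eventually hC).frequently

theorem cauchySeq_weakGradL2 {u : ℕ → submoduleE hN} (hu : CauchySeq u) :
    CauchySeq fun n => weakGradL2 hN (u n) :=
  (AddMonoidHomClass.lipschitz_of_bound (weakGradL2 hN) 1 fun u => by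
    simpa only [one_mul] using norm_weakGradL2_le u).uniformContinuous.comp_cauchySeq hu

theorem cauchySeq_toSobolevLp [Fact (1 ≤ sobolevExponent N)] {u : ℕ → submoduleE hN}
    (hu : CauchySeq u) : CauchySeq fun n => toSobolevLp hN (u n) :=
  (AddMonoidHomClass.lipschitz_of_bound (toSobolevLp hN) (sobolevConst N) fun u =>
    (norm_toSobolevLp_le u).trans (mul_le_mul_of_nonneg_left (norm_weakGradL2_le u)
      (NNReal.coe_nonneg _))).uniformContinuous.comp_cauchySeq hu

theorem tendsto_submoduleE {ι : Type*} {l : Filter ι} {u : ι → submoduleE hN} {v : submoduleE hN}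
    (hgrad : Tendsto (fun i => weakGradL2 hN (u i)) l (𝓝 (weakGradL2 hN v)))
    (hcoulomb : Tendsto (fun i => coulombSeminorm hN (u i - v)) l (𝓝 0)) :
    Tendsto u l (𝓝 v) := by
  rw [tendsto_iff_norm_sub_tendsto_zero] at hgrad ⊢
  simpa only [norm_submoduleE_eq, map_sub, zero_pow two_ne_zero, add_zero, Real.sqrt_zero] using
    ((hgrad.pow 2).add (hcoulomb.pow 2)).sqrt

theorem exists_toSobolevLp_eq_weakGradL2_eq [Fact (1 ≤ sobolevExponent N)]
    {u : ℕ → submoduleE hN} (hu : CauchySeq u)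
    {f : Lp ℝ (sobolevExponent N) (volume : Measure (Space N))}
    {g : Lp (Space N) 2 (volume : Measure (Space N))}
    (hf : Tendsto (fun n => toSobolevLp hN (u n)) atTop (𝓝 f))
    (hg : Tendsto (fun n => weakGradL2 hN (u n)) atTop (𝓝 g)) :
    ∃ v : submoduleE hN, toSobolevLp hN v = f ∧ weakGradL2 hN v = g := by
  have hgrad (n : ℕ) : IsWeakGradient (toSobolevLp hN (u n)) (weakGradL2 hN (u n)) :=
    (u n).2.1.isWeakGradient.congr .rfl (coeFn_weakGradL2 (u n)).symm
  have hweak : IsWeakGradient f g :=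
    .of_tendsto Fact.out one_le_two hgrad
      (fun n => Lp.memLp (toSobolevLp hN (u n))) (fun n => Lp.memLp (weakGradL2 hN (u n)))
      (Lp.memLp f) (Lp.memLp g)
      ((Lp.tendsto_Lp_iff_tendsto_eLpNorm' _ _).1 hf)
      ((Lp.tendsto_Lp_iff_tendsto_eLpNorm' _ _).1 hg)
  obtain ⟨C, hC, hbound⟩ := hu.isBounded_range.exists_pos_norm_le
  have hfin : coulombEnergy f ≤ ENNReal.ofReal (C ^ 4) := by
    refine coulombEnergy_le_of_tendsto hf (Eventually.of_forall fun n => ?_)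
    rw [coeFn_toSobolevLp, ← coulombSeminorm_le_iff hC.le]
    exact (coulombSeminorm_le_norm _).trans (hbound _ (Set.mem_range_self n))
  refine ⟨⟨f.1, hweak.memD12 .rfl (Lp.memLp f) (Lp.memLp g),
    hfin.trans_lt ENNReal.ofReal_lt_top⟩, rfl, Lp.ext ?_⟩
  exact (coeFn_weakGradL2 _).trans (hweak.weakGrad_ae_eq .rfl)

theorem tendsto_coulombSeminorm_sub [Fact (1 ≤ sobolevExponent N)] {u : ℕ → submoduleE hN}
    (hu : CauchySeq u) {v : submoduleE hN}
    (hv : Tendsto (fun n => toSobolevLp hN (u n)) atTop (𝓝 (toSobolevLp hN v))) :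
    Tendsto (fun n => coulombSeminorm hN (u n - v)) atTop (𝓝 0) := by
  refine tendsto_order.2 ⟨fun a ha => Eventually.of_forall fun n => ha.trans_le (apply_nonneg _ _),
    fun ε hε => ?_⟩
  obtain ⟨n₀, hn₀⟩ := Metric.cauchySeq_iff.1 hu (ε / 2) (half_pos hε)
  filter_upwards [eventually_ge_atTop n₀] with n hn
  have hlim : Tendsto (fun m => toSobolevLp hN (u n - u m)) atTop
      (𝓝 (toSobolevLp hN (u n - v))) := by
    simpa only [map_sub] using hv.const_sub (toSobolevLp hN (u n))
  refine lt_of_le_of_lt ?_ (half_lt_self hε)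
  rw [coulombSeminorm_le_iff (half_pos hε).le, ← coeFn_toSobolevLp]
  refine coulombEnergy_le_of_tendsto hlim ?_
  filter_upwards [eventually_ge_atTop n₀] with m hm
  rw [coeFn_toSobolevLp, ← coulombSeminorm_le_iff (half_pos hε).le]
  exact (coulombSeminorm_le_norm _).trans (dist_eq_norm (u n) (u m) ▸ (hn₀ n hn m hm).le)

instance : CompleteSpace (submoduleE hN) := by
  have : Fact (1 ≤ sobolevExponent N) := ⟨one_le_sobolevExponent hN⟩
  refine Metric.complete_of_cauchySeq_tendsto fun u hu => ?_
  obtain ⟨f, hf⟩ := cauchySeq_tendsto_of_complete (cauchySeq_toSobolevLp hu)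
  obtain ⟨g, hg⟩ := cauchySeq_tendsto_of_complete (cauchySeq_weakGradL2 hu)
  obtain ⟨v, rfl, rfl⟩ := exists_toSobolevLp_eq_weakGradL2_eq hu hf hg
  exact ⟨v, tendsto_submoduleE hg (tendsto_coulombSeminorm_sub hu hf)⟩

instance : UniformConvexSpace (submoduleE hN) :=
  uniformConvexSpace_of_clarkson (T := (weakGradL2 hN).toAddMonoidHom)
    (b := (coulombSeminorm hN).toAddGroupSeminorm) norm_submoduleE_sq coulombSeminorm_clarkson

end Limits

section Density

variable {N : ℕ} {hN : 3 ≤ N} {φ : Space N → ℝ}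

/-- The class of a test function as an element of `E(ℝ^N)`. -/
noncomputable def IsTestFunction.toE (hN : 3 ≤ N) (hφ : IsTestFunction φ) : submoduleE hN :=
  ⟨AEEqFun.mk φ hφ.1.continuous.aestronglyMeasurable, hφ.mem_spaceE hN (AEEqFun.coeFn_mk _ _)⟩

theorem IsTestFunction.coeFn_toE (hφ : IsTestFunction φ) : (hφ.toE hN).1 =ᵐ[volume] φ :=
  AEEqFun.coeFn_mk _ _

theorem isTestFunction_cutoffMollify_coe (n : ℕ) (u : submoduleE hN) :
    IsTestFunction (cutoffMollify n u.1) :=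
  isTestFunction_cutoffMollify n u.2.1.isWeakGradient.locallyIntegrable

theorem IsTestFunction.weakGradL2_toE_ae_eq (hφ : IsTestFunction φ) :
    weakGradL2 hN (hφ.toE hN) =ᵐ[volume] gradient φ :=
  (coeFn_weakGradL2 _).trans
    ((isWeakGradient_gradient (hφ.1.of_le (by simp))).weakGrad_ae_eq hφ.coeFn_toE)

theorem tendsto_toE_cutoffMollify (u : submoduleE hN) :
    Tendsto (fun n => (isTestFunction_cutoffMollify_coe n u).toE hN) atTop (𝓝 u) := by
  have : (sobolevExponent N).HolderTriple N 2 := holderTriple_sobolevExponent hN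
  have hu := u.2.1.isWeakGradient
  refine tendsto_submoduleE ((Lp.tendsto_Lp_iff_tendsto_eLpNorm' _ _).2 ?_) ?_
  · refine (hu.tendsto_eLpNorm_gradient_cutoffMollify_sub (one_le_sobolevExponent hN)
      sobolevExponent_ne_top u.2.1.memLp u.2.1.memLp_weakGrad).congr fun n => eLpNorm_congr_ae ?_
    exact ((isTestFunction_cutoffMollify_coe n u).weakGradL2_toE_ae_eq.sub
      (coeFn_weakGradL2 u)).symm
  · have henergy (n : ℕ) :
        coulombEnergy ((isTestFunction_cutoffMollify_coe n u).toE hN - u).1 =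
          coulombEnergy (cutoffMollify n u.1 - (u.1 : Space N → ℝ)) :=
      coulombEnergy_congr ((AEEqFun.coeFn_sub _ _).trans
        ((isTestFunction_cutoffMollify_coe n u).coeFn_toE.sub .rfl))
    have hlim := (tendsto_coulombEnergy_cutoffMollify_sub hN u.1.stronglyMeasurable
      hu.locallyIntegrable u.2.2.ne).ennrpow_const (1 / 4)
    rw [ENNReal.zero_rpow_of_pos (by norm_num)] at hlim
    simpa only [coulombSeminorm_apply, henergy, Function.comp_def, ENNReal.toReal_zero] using
      (ENNReal.tendsto_toReal ENNReal.zero_ne_top).comp hlim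

theorem dense_testClasses (hN : 3 ≤ N) : Dense {u : submoduleE hN | u.1 ∈ testClasses N} :=
  fun u => mem_closure_of_tendsto (tendsto_toE_cutoffMollify u) <| Eventually.of_forall fun n =>
    ⟨_, isTestFunction_cutoffMollify_coe n u, (isTestFunction_cutoffMollify_coe n u).coeFn_toE⟩

theorem spaceEr_subset_closure_radialTestClasses (hN : 3 ≤ N) :
    {u : submoduleE hN | u.1 ∈ spaceEr N} ⊆
      closure {u : submoduleE hN | u.1 ∈ radialTestClasses N} := by
  rintro u ⟨-, f, hf, huf⟩
  refine mem_closure_of_tendsto (tendsto_toE_cutoffMollify u) (Eventually.of_forall fun n => ?_)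
  have hrad : IsRadial (cutoffMollify n u.1) := by
    have hcongr : cutoffMollify n u.1 = cutoffMollify n f :=
      congr(fun x => cutoff n x • $(mollify_congr_ae n huf) x)
    exact hcongr ▸ hf.cutoffMollify n
  exact ⟨_, isTestFunction_cutoffMollify_coe n u, hrad,
    (isTestFunction_cutoffMollify_coe n u).coeFn_toE⟩

end Density

theorem proposition2p1 (N : ℕ) (hN : 3 ≤ N) :
    testClasses N ⊆ spaceE N ∧ radialTestClasses N ⊆ spaceEr N ∧
    ∃ V : Submodule ℝ (Space N →ₘ[volume] ℝ), (V : Set (Space N →ₘ[volume] ℝ)) = spaceE N ∧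
      letI : Norm V := ⟨fun u => normE (u : Space N →ₘ[volume] ℝ)⟩
      -- `normE` is a norm on the vector space `V = E(ℝ^N)`; what follows is for this norm
      ∃ core : NormedSpace.Core ℝ V,
        letI : NormedAddCommGroup V := NormedAddCommGroup.ofCore core
        CompleteSpace V ∧
        UniformConvexSpace V ∧
        Dense {u : V | (u : Space N →ₘ[volume] ℝ) ∈ testClasses N} ∧
        {u : V | (u : Space N →ₘ[volume] ℝ) ∈ spaceEr N} ⊆
          closure {u : V | (u : Space N →ₘ[volume] ℝ) ∈ radialTestClasses N} :=
  ⟨testClasses_subset_spaceE hN, radialTestClasses_subset_spaceEr hN, submoduleE hN, rfl,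
    core_submoduleE hN, inferInstanceAs (CompleteSpace (submoduleE hN)),
    inferInstanceAs (UniformConvexSpace (submoduleE hN)), dense_testClasses hN,
    spaceEr_subset_closure_radialTestClasses hN⟩
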